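/- Let $K\subset\mathbb{R}^2$ be a compact, strictly convex set with nonempty interior whose boundary $\gamma$ is a simple closed regular $C^\infty$ curve with everywhere positive curvature. Let $p(\theta)=\max_{x\in K}\langle x,(\cos\theta,\sin\theta)\rangle$ be its support function, and parametrize $\gamma$ by the angle $\theta\in[0,2\pi]$ of its outward normal: $$\gamma(\theta)=\bigl(p(\theta)\cos\theta-p'(\theta)\sin\theta,\; p(\theta)\sin\theta+p'(\theta)\cos\theta\bigr).$$ Let $\kappa(\theta)$ be the curvature of $\gamma$, $\rho=1/\kappa$ its curvature radius, $\rho_M$ and $\rho_m$ the maximum and minimum of $\rho$, $L$ the length of $\gamma$, $A$ the area of $K$, and $\rho_e$ and $\rho_i$ the circumradius (least radius of a disk containing $K$) and inradius (greatest radius of a disk contained in $K$). Let $\beta(\theta)=\gamma(\theta)-\rho(\theta)(\cos\theta,\sin\theta)$ be the locus of curvature centers, $\tilde A=\frac12\int_0^{2\pi}(\beta_1\beta_2'-\beta_2\beta_1')\,\mathrm{d}\theta$ its oriented area and $\rho_\beta(\theta)$ its curvature radius (taken to be $0$ where $\beta'(\theta)=0$), that is, $\rho_\beta=|p'+p'''|$.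 For real parameters $\alpha,\delta,\mu,\sigma,\eta,\lambda,\xi,\zeta$ put $$W=\alpha\int_0^{2\pi}\rho(\theta)^2\,\mathrm{d}\theta+\delta L^2+\mu A+\sigma|\tilde A|+\eta\int_0^{2\pi}\rho_\beta(\theta)^2\,\mathrm{d}\theta+\lambda(\rho_e-\rho_i)^2+\xi(\rho_M-\rho_m)^2+\zeta\oint_\gamma\kappa^2\,\mathrm{d}s.$$ Suppose that $$\eta,\xi\ge 0,\quad \lambda\le 0,\quad \lambda^2+\xi^2>0,\quad \zeta=0,\quad 2\alpha+4\pi\delta+\mu=0,$$ $$2\alpha+\sigma-2\eta\ge 0,\qquad 6\pi\alpha-\pi\mu+4\pi\sigma+24\pi\eta+4\lambda+4\xi\ge 0.$$ Then $W\ge 0$, and $W=0$ if and only if $K$ is a disk. -/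

import Mathlib

open scoped ContDiff

noncomputable section

namespace PlaneConvex

/-- The Euclidean plane. -/
abbrev Plane : Type := EuclideanSpace ℝ (Fin 2)

/-- Outward unit normal at normal angle `θ`. -/
def normalDir (θ : ℝ) : Plane := !₂[Real.cos θ, Real.sin θ]

/-- Signed curvature `(c₁' c₂'' - c₂' c₁'') / |c'|³` of a parametrized plane curve. -/
def curvature (c : ℝ → Plane) (t : ℝ) : ℝ :=
  (deriv c t 0 * deriv (deriv c) t 1 - deriv c t 1 * deriv (deriv c) t 0) / ‖deriv c t‖ ^ 3

/-- A compact strictly convex set with nonempty interior whose boundary is a simple closed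
regular `C^∞` curve of positive curvature (for its counterclockwise parametrization). -/
structure IsSmoothStrictlyConvexDomain (K : Set Plane) : Prop where
  isCompact : IsCompact K
  strictConvex : StrictConvex ℝ K
  nonempty_interior : (interior K).Nonempty
  smooth_boundary : ∃ (T : ℝ) (c : ℝ → Plane), 0 < T ∧ ContDiff ℝ ∞ c ∧ Function.Periodic c T ∧
    Set.InjOn c (Set.Ico 0 T) ∧ Set.range c = frontier K ∧
    (∀ t, deriv c t ≠ 0) ∧ ∀ t, 0 < curvature c t

/-- `K` is a closed round disk of positive radius. -/
def IsDisk (K : Set Plane) : Prop :=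
  ∃ (x : Plane) (r : ℝ), 0 < r ∧ K = Metric.closedBall x r

/-- The support function of `K`, as a function of the normal angle. -/
def supportFun (K : Set Plane) (θ : ℝ) : ℝ :=
  sSup ((fun x : Plane => inner ℝ x (normalDir θ)) '' K)

/-- The boundary curve of `K`, parametrized by the normal angle. -/
def boundaryCurve (K : Set Plane) (θ : ℝ) : Plane :=
  !₂[supportFun K θ * Real.cos θ - deriv (supportFun K) θ * Real.sin θ,
     supportFun K θ * Real.sin θ + deriv (supportFun K) θ * Real.cos θ]

/-- The curvature `κ` of the boundary at normal angle `θ`. -/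
def kappa (K : Set Plane) (θ : ℝ) : ℝ := curvature (boundaryCurve K) θ

/-- The curvature radius `ρ = 1 / κ` of the boundary at normal angle `θ`. -/
def rho (K : Set Plane) (θ : ℝ) : ℝ := 1 / kappa K θ

/-- The perimeter `L`: arc length of the boundary curve. -/
def perimeter (K : Set Plane) : ℝ :=
  ∫ θ in (0 : ℝ)..2 * Real.pi, ‖deriv (boundaryCurve K) θ‖

/-- The area `A` of `K` (Lebesgue measure). -/
def area (K : Set Plane) : ℝ := (MeasureTheory.volume K).toReal

/-- The locus `β` of curvature centers: the boundary point moved by `ρ` along the inward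
unit normal. -/
def centerLocus (K : Set Plane) (θ : ℝ) : Plane :=
  boundaryCurve K θ + rho K θ • (-normalDir θ)

/-- The oriented area `½ ∮ c₁ dc₂ - c₂ dc₁` of a closed curve on `[0, 2π]`. -/
def orientedArea (c : ℝ → Plane) : ℝ :=
  (1 / 2) * ∫ θ in (0 : ℝ)..2 * Real.pi, (c θ 0 * deriv c θ 1 - c θ 1 * deriv c θ 0)

/-- The oriented area of the domain enclosed by the locus of curvature centers. -/
def areaTilde (K : Set Plane) : ℝ := orientedArea (centerLocus K)

/-- The curvature radius `|1 / κ_β|` of the locus of curvature centers. At the cusps of `β`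
(where `β' = 0`, that is `ρ' = 0`) the value is `0`, so that it equals `|ρ'| = |p' + p'''|`
for all `θ`. -/
def rhoBeta (K : Set Plane) (θ : ℝ) : ℝ := |1 / curvature (centerLocus K) θ|

/-- The circumradius: least radius of a disk containing `K`. -/
def circumradius (K : Set Plane) : ℝ :=
  sInf {r : ℝ | 0 ≤ r ∧ ∃ x : Plane, K ⊆ Metric.closedBall x r}

/-- The inradius: greatest radius of a disk contained in `K`. -/
def inradius (K : Set Plane) : ℝ :=
  sSup {r : ℝ | 0 ≤ r ∧ ∃ x : Plane, Metric.closedBall x r ⊆ K}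

/-- The maximum of the curvature radius. -/
def rhoMax (K : Set Plane) : ℝ := sSup (rho K '' Set.Icc 0 (2 * Real.pi))

/-- The minimum of the curvature radius. -/
def rhoMin (K : Set Plane) : ℝ := sInf (rho K '' Set.Icc 0 (2 * Real.pi))

/-- The integral of `κ²` with respect to arc length along the boundary. -/
def curvatureEnergy (K : Set Plane) : ℝ :=
  ∫ θ in (0 : ℝ)..2 * Real.pi, kappa K θ ^ 2 * ‖deriv (boundaryCurve K) θ‖

/-- The functional `W` with parameters `α, δ, μ, σ, η, λ, ξ, ζ`. -/
def W (α δ μ σ η lam ξ ζ : ℝ) (K : Set Plane) : ℝ :=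
  α * (∫ θ in (0 : ℝ)..2 * Real.pi, rho K θ ^ 2)
    + δ * perimeter K ^ 2 + μ * area K + σ * |areaTilde K|
    + η * (∫ θ in (0 : ℝ)..2 * Real.pi, rhoBeta K θ ^ 2)
    + lam * (circumradius K - inradius K) ^ 2
    + ξ * (rhoMax K - rhoMin K) ^ 2
    + ζ * curvatureEnergy K

end PlaneConvex

end

open scoped ContDiff

noncomputable section

namespace PlaneConvex

open Real MeasureTheory intervalIntegral Filter Topology

/-! Everything reduces to the normalized isoperimetric deficit E = (L² - 4πA)/(2π), which is
`deficit`. Let X = ∫p''² - ∫p'², Y = ∫(p' + p''')², D = (ρ_e - ρ_i)² and V = (ρ_M - ρ_m)². Cauchy's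
formulas and integration by parts give ∫ρ² = X - E + L²/(2π), 2A = L²/(2π) - E and Ã = -X/2. The
condition 2α + 4πδ + μ = 0 cancels exactly the L² terms, so W = (2α + σ)X/2 - (2α + μ)E/2 + ηY + λD
+ ξV.

Four sharp or nearly sharp inequalities compare the other quantities with E. By Parseval, X ≥ 4E and
Y ≥ 12E, because (n² - 1)(n² - 4) ≥ 0 for every integer n. Bonnesen's inequality πD ≤ 2E is strict
unless K is a disk. Bottema's inequality, in the strengthened form 6E ≤ πV, follows from bounding
the variance of ρ by its range and from X ≥ 4E. Inserting the Fourier bounds shows that πW is at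
least (6πα - πμ + 4πσ + 24πη + 4λ + 4ξ)E/2 + (-λ)(2E - πD) + ξ(πV - 2E), a sum of nonnegative terms.
Away from disks E > 0, and one of the last two terms is positive according to which of λ, ξ is
nonzero.

Bonnesen's inequality comes from Wirtinger's inequality. Measured from the centre of the
circumscribed or inscribed circle, the gap q between p and the radius has constant sign. Optimality
of the circle forces a contact in every closed half-turn, so the zeros of q cut the period into arcs
of length at most π, and ∫(q'² - q²) ≥ 0 on each arc. -/

/-! ### Fourier coefficients and Parseval's identity -/

/-- Fourier coefficients of a real function on `[0, 2π]`. -/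
def coeff (f : ℝ → ℝ) (n : ℤ) : ℂ :=
  fourierCoeffOn two_pi_pos (fun x => (f x : ℂ)) n

theorem coeff_deriv {f f' : ℝ → ℝ} (hf : ∀ x, HasDerivAt f (f' x) x) (hf' : Continuous f')
    (hper : Function.Periodic f (2 * π)) (n : ℤ) :
    coeff f' n = Complex.I * n * coeff f n := by
  have h0 : f (2 * π) = f 0 := by simpa using hper 0
  by_cases hn : n = 0
  · subst hn
    have h2 : ∫ x in (0 : ℝ)..2 * π, (f' x : ℂ) = 0 := by
      rw [intervalIntegral.integral_ofReal, integral_eq_sub_of_hasDerivAt (fun x _ => hf x)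
        (hf'.intervalIntegrable _ _), h0]
      simp
    simp [coeff, fourierCoeffOn_eq_integral, h2]
  · have h := fourierCoeffOn_of_hasDerivAt (f := fun x => (f x : ℂ)) (f' := fun x => (f' x : ℂ))
      two_pi_pos hn (fun x _ => (hf x).ofReal_comp)
      ((Complex.continuous_ofReal.comp hf').intervalIntegrable _ _)
    have hnC : (n : ℂ) ≠ 0 := by exact_mod_cast hn
    have hpi : (π : ℂ) ≠ 0 := by exact_mod_cast pi_ne_zero
    unfold coeff
    rw [h, h0]
    field_simp
    push_cast
    ring_nf

theorem coeff_add {f g : ℝ → ℝ} (hf : Continuous f) (hg : Continuous g) (n : ℤ) :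
    coeff (fun x => f x + g x) n = coeff f n + coeff g n := by
  unfold coeff
  rw [fourierCoeffOn_eq_integral, fourierCoeffOn_eq_integral, fourierCoeffOn_eq_integral,
    ← smul_add, ← intervalIntegral.integral_add]
  · congr 1
    refine integral_congr fun x _ => ?_
    simp [mul_add]
  all_goals
    apply Continuous.intervalIntegrable
    have : Continuous fun x : ℝ => fourier (-n) (x : AddCircle (2 * π - 0)) :=
      (ContinuousMap.continuous _).comp (AddCircle.continuous_mk' _)
    fun_prop

theorem coeff_zero (f : ℝ → ℝ) : ‖coeff f 0‖ ^ 2 = (∫ x in (0 : ℝ)..2 * π, f x) ^ 2 / (2 * π) ^ 2 := by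
  have h : coeff f 0 = (((2 * π)⁻¹ * ∫ x in (0 : ℝ)..2 * π, f x : ℝ) : ℂ) := by
    simp [coeff, fourierCoeffOn_eq_integral, intervalIntegral.integral_ofReal]
  rw [h, Complex.norm_real, norm_eq_abs, sq_abs]
  field_simp

theorem hasSum_coeff {f : ℝ → ℝ} (hf : Continuous f) :
    HasSum (fun n => 2 * π * ‖coeff f n‖ ^ 2) (∫ x in (0 : ℝ)..2 * π, f x ^ 2) := by
  have h := hasSum_sq_fourierCoeffOn (f := fun x => (f x : ℂ)) two_pi_pos (by
    have hc : Continuous fun x => (f x : ℂ) := by fun_prop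
    obtain ⟨C, hC⟩ := (isCompact_Icc (a := (0 : ℝ)) (b := 2 * π)).exists_bound_of_continuousOn
      hc.continuousOn
    refine MemLp.of_bound hc.aestronglyMeasurable C ?_
    exact (ae_restrict_iff' measurableSet_Ioc).2
      (.of_forall fun x hx => hC x (Set.Ioc_subset_Icc_self hx)))
  have h2 := h.mul_left (2 * π)
  simp only [Complex.norm_real, norm_eq_abs, sq_abs, smul_eq_mul, sub_zero] at h2
  rwa [← mul_assoc, mul_inv_cancel₀ two_pi_pos.ne', one_mul] at h2

/-- The data of a thrice continuously differentiable `2π`-periodic function. -/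
structure PeriodicC3 (p p₁ p₂ p₃ : ℝ → ℝ) : Prop where
  d0 : ∀ x, HasDerivAt p (p₁ x) x
  d1 : ∀ x, HasDerivAt p₁ (p₂ x) x
  d2 : ∀ x, HasDerivAt p₂ (p₃ x) x
  c3 : Continuous p₃
  per : Function.Periodic p (2 * π)

namespace PeriodicC3

variable {p p₁ p₂ p₃ : ℝ → ℝ}

theorem c0 (h : PeriodicC3 p p₁ p₂ p₃) : Continuous p :=
  continuous_iff_continuousAt.2 fun x => (h.d0 x).continuousAt

theorem c1 (h : PeriodicC3 p p₁ p₂ p₃) : Continuous p₁ :=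
  continuous_iff_continuousAt.2 fun x => (h.d1 x).continuousAt

theorem c2 (h : PeriodicC3 p p₁ p₂ p₃) : Continuous p₂ :=
  continuous_iff_continuousAt.2 fun x => (h.d2 x).continuousAt

end PeriodicC3

theorem periodic_of_hasDerivAt {f f' : ℝ → ℝ} (hf : ∀ x, HasDerivAt f (f' x) x) {T : ℝ}
    (hper : Function.Periodic f T) : Function.Periodic f' T := fun x => by
  have h1 := (hf (x + T)).comp_add_const x T
  have h2 : (fun x => f (x + T)) = f := funext hper
  rw [h2] at h1
  exact h1.unique (hf x)

/-! ### Spectral inequalities and integral identities for the deficit -/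

/-- The squares of integers skip the open interval (1, 4). -/
theorem sq_sub_mul_nonneg (n : ℤ) : 0 ≤ ((n : ℝ) ^ 2 - 1) * ((n : ℝ) ^ 2 - 4) := by
  have h : 0 ≤ (n ^ 2 - 1) * (n ^ 2 - 4) := by
    have h1 : 0 ≤ n ^ 2 := sq_nonneg n
    rcases le_or_gt (n ^ 2) 1 with h2 | h2
    · nlinarith
    · have h3 : 2 ≤ |n| := by
        by_contra! h4
        have := abs_nonneg n
        have h5 := sq_abs n
        nlinarith
      have h5 := sq_abs n
      exact mul_nonneg (by nlinarith) (by nlinarith)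
  exact_mod_cast h

/-- The isoperimetric deficit of a support function, divided by `2π`. -/
def deficit (p p₁ : ℝ → ℝ) : ℝ :=
  (∫ x in (0 : ℝ)..2 * π, p₁ x ^ 2) - (∫ x in (0 : ℝ)..2 * π, p x ^ 2)
    + (∫ x in (0 : ℝ)..2 * π, p x) ^ 2 / (2 * π)

namespace PeriodicC3

variable {p p₁ p₂ p₃ : ℝ → ℝ}

theorem per1 (h : PeriodicC3 p p₁ p₂ p₃) : Function.Periodic p₁ (2 * π) :=
  periodic_of_hasDerivAt h.d0 h.per

theorem per2 (h : PeriodicC3 p p₁ p₂ p₃) : Function.Periodic p₂ (2 * π) :=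
  periodic_of_hasDerivAt h.d1 h.per1

theorem parseval (h : PeriodicC3 p p₁ p₂ p₃) : ∃ a : ℤ → ℝ, (∀ n, 0 ≤ a n) ∧
    a 0 = (∫ x in (0 : ℝ)..2 * π, p x) ^ 2 / (2 * π) ∧
    HasSum a (∫ x in (0 : ℝ)..2 * π, p x ^ 2) ∧
    HasSum (fun n : ℤ => (n : ℝ) ^ 2 * a n) (∫ x in (0 : ℝ)..2 * π, p₁ x ^ 2) ∧
    HasSum (fun n : ℤ => (n : ℝ) ^ 4 * a n) (∫ x in (0 : ℝ)..2 * π, p₂ x ^ 2) ∧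
    HasSum (fun n : ℤ => ((n : ℝ) ^ 2 - 1) ^ 2 * a n) (∫ x in (0 : ℝ)..2 * π, (p x + p₂ x) ^ 2) ∧
    HasSum (fun n : ℤ => (n : ℝ) ^ 2 * ((n : ℝ) ^ 2 - 1) ^ 2 * a n)
      (∫ x in (0 : ℝ)..2 * π, (p₁ x + p₃ x) ^ 2) := by
  have e1 := coeff_deriv h.d0 h.c1 h.per
  have e2 := coeff_deriv h.d1 h.c2 h.per1
  have e3 : ∀ n, coeff (fun x => p x + p₂ x) n = ((1 - (n : ℝ) ^ 2 : ℝ) : ℂ) * coeff p n := by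
    intro n
    rw [coeff_add h.c0 h.c2, e2, e1]
    push_cast
    linear_combination (n : ℂ) ^ 2 * coeff p n * Complex.I_sq
  have e4 := coeff_deriv (f := fun x => p x + p₂ x) (f' := fun x => p₁ x + p₃ x)
    (fun x => (h.d0 x).add (h.d2 x)) (h.c1.add h.c3)
    (fun x => by simp only [h.per x, h.per2 x])
  refine ⟨fun n => 2 * π * ‖coeff p n‖ ^ 2, fun n => by positivity, ?_, hasSum_coeff h.c0, ?_, ?_,
    ?_, ?_⟩
  · simp only [coeff_zero]
    field_simp
  · convert hasSum_coeff h.c1 using 2 with n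
    rw [e1, norm_mul, norm_mul, Complex.norm_I, Complex.norm_intCast, mul_pow, mul_pow, sq_abs]
    ring
  · convert hasSum_coeff h.c2 using 2 with n
    rw [e2, e1, norm_mul, norm_mul, norm_mul, norm_mul, Complex.norm_I, Complex.norm_intCast,
      mul_pow, mul_pow, mul_pow, mul_pow, sq_abs]
    ring
  · convert hasSum_coeff (f := fun x => p x + p₂ x) (h.c0.add h.c2) using 2 with n
    rw [e3, norm_mul, Complex.norm_real, mul_pow, norm_eq_abs, sq_abs]
    ring
  · convert hasSum_coeff (f := fun x => p₁ x + p₃ x) (h.c1.add h.c3) using 2 with n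
    rw [e4, e3, norm_mul, norm_mul, norm_mul, Complex.norm_I, Complex.norm_intCast,
      Complex.norm_real, mul_pow, mul_pow, mul_pow, norm_eq_abs, sq_abs, sq_abs]
    ring

/-- On mode n the two sides have weights 4(n² - 1) and n²(n² - 1), which differ by (n² - 1)(n² - 4).
Mode 0 drops out because the squared mean in the deficit cancels its weight -1. -/
theorem four_mul_deficit_le (h : PeriodicC3 p p₁ p₂ p₃) :
    4 * deficit p p₁ ≤
      (∫ x in (0 : ℝ)..2 * π, p₂ x ^ 2) - ∫ x in (0 : ℝ)..2 * π, p₁ x ^ 2 := by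
  obtain ⟨a, ha, a0, s0, s1, s2, -, -⟩ := h.parseval
  have s := ((s2.sub s1).sub ((s1.sub s0).mul_left 4)).sub ((hasSum_ite_eq (0 : ℤ) (a 0)).mul_left 4)
  have := s.nonneg fun n => by
    by_cases hn : n = 0
    · subst hn; simp
    · have := mul_nonneg (sq_sub_mul_nonneg n) (ha n)
      simp only [hn, if_false]
      linarith
  unfold deficit
  rw [← a0]
  linarith

/-- The difference of the weights factors as n²(n² - 1)² - 12(n² - 1) = (n² - 1)(n² - 4)(n² + 3). -/
theorem twelve_mul_deficit_le (h : PeriodicC3 p p₁ p₂ p₃) :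
    12 * deficit p p₁ ≤ ∫ x in (0 : ℝ)..2 * π, (p₁ x + p₃ x) ^ 2 := by
  obtain ⟨a, ha, a0, s0, s1, s2, -, s4⟩ := h.parseval
  have s := (s4.sub ((s1.sub s0).mul_left 12)).sub ((hasSum_ite_eq (0 : ℤ) (a 0)).mul_left 12)
  have := s.nonneg fun n => by
    by_cases hn : n = 0
    · subst hn; simp
    · have := mul_nonneg (mul_nonneg (sq_sub_mul_nonneg n)
        (by positivity : 0 ≤ (n : ℝ) ^ 2 + 3)) (ha n)
      simp only [hn, if_false]
      linarith
  unfold deficit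
  rw [← a0]
  linarith

theorem integral_rho_sq (h : PeriodicC3 p p₁ p₂ p₃) :
    ∫ x in (0 : ℝ)..2 * π, (p x + p₂ x) ^ 2 =
      (∫ x in (0 : ℝ)..2 * π, p₂ x ^ 2) - (∫ x in (0 : ℝ)..2 * π, p₁ x ^ 2) - deficit p p₁
        + (∫ x in (0 : ℝ)..2 * π, p x) ^ 2 / (2 * π) := by
  obtain ⟨a, ha, a0, s0, s1, s2, s3, -⟩ := h.parseval
  have s := (s2.sub s1).sub (s1.sub s0)
  have e := s3.unique (s.congr_fun fun n => by ring)
  unfold deficit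
  linarith

theorem integral_mul_deriv_neg {f f' g g' : ℝ → ℝ} (hf : ∀ x, HasDerivAt f (f' x) x)
    (hg : ∀ x, HasDerivAt g (g' x) x) (hf' : Continuous f') (hg' : Continuous g')
    (hfp : Function.Periodic f (2 * π)) (hgp : Function.Periodic g (2 * π)) :
    ∫ x in (0 : ℝ)..2 * π, f x * g' x = -∫ x in (0 : ℝ)..2 * π, f' x * g x := by
  rw [integral_mul_deriv_eq_deriv_mul (fun x _ => hf x) (fun x _ => hg x)
    (hf'.intervalIntegrable _ _) (hg'.intervalIntegrable _ _)]
  have h1 := hfp 0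
  have h2 := hgp 0
  rw [zero_add] at h1 h2
  rw [h1, h2]
  ring

theorem integral_mul_rho (h : PeriodicC3 p p₁ p₂ p₃) :
    ∫ x in (0 : ℝ)..2 * π, p x * (p x + p₂ x) =
      (∫ x in (0 : ℝ)..2 * π, p x) ^ 2 / (2 * π) - deficit p p₁ := by
  have := integral_mul_deriv_neg h.d0 h.d1 h.c1 h.c2 h.per h.per1
  simp only [mul_add]
  rw [intervalIntegral.integral_add, this]
  · unfold deficit
    simp only [← sq]
    ring
  all_goals
    have := h.c0
    have := h.c2
    apply Continuous.intervalIntegrable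
    fun_prop

theorem integral_deriv_mul_rho_deriv (h : PeriodicC3 p p₁ p₂ p₃) :
    ∫ x in (0 : ℝ)..2 * π, p₁ x * (p₁ x + p₃ x) =
      -((∫ x in (0 : ℝ)..2 * π, p₂ x ^ 2) - ∫ x in (0 : ℝ)..2 * π, p₁ x ^ 2) := by
  have := integral_mul_deriv_neg h.d1 h.d2 h.c2 h.c3 h.per1 h.per2
  simp only [mul_add]
  rw [intervalIntegral.integral_add, this]
  · simp only [← sq]
    ring
  all_goals
    have := h.c1
    have := h.c3
    apply Continuous.intervalIntegrable
    fun_prop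

theorem integral_rho (h : PeriodicC3 p p₁ p₂ p₃) :
    ∫ x in (0 : ℝ)..2 * π, (p x + p₂ x) = ∫ x in (0 : ℝ)..2 * π, p x := by
  have hp := h.per1 0
  rw [zero_add] at hp
  rw [intervalIntegral.integral_add (h.c0.intervalIntegrable _ _) (h.c2.intervalIntegrable _ _),
    integral_eq_sub_of_hasDerivAt (fun x _ => h.d1 x) (h.c2.intervalIntegrable _ _), hp]
  simp

end PeriodicC3

/-! ### Wirtinger's inequality on arcs between zeros -/

theorem tendsto_sq_div_sin {q : ℝ → ℝ} {q' c : ℝ} (hq : HasDerivAt q q' c) (hc : q c = 0) :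
    Tendsto (fun x => q x ^ 2 / sin (x - c)) (𝓝[≠] c) (𝓝 0) := by
  have hs : HasDerivAt (fun x => sin (x - c)) 1 c := by
    simpa using (hasDerivAt_id c).sub_const c |>.sin
  have h1 := hasDerivAt_iff_tendsto_slope.1 hq
  have h2 := hasDerivAt_iff_tendsto_slope.1 hs
  have h3 : Tendsto q (𝓝[≠] c) (𝓝 (q c)) := hq.continuousAt.tendsto.mono_left inf_le_left
  have h4 := (h3.mul h1).div h2 one_ne_zero
  rw [hc, zero_mul, zero_div] at h4
  refine h4.congr' ?_
  filter_upwards [self_mem_nhdsWithin] with x hx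
  have hx : x - c ≠ 0 := sub_ne_zero.2 hx
  simp only [slope_def_field, Pi.div_apply, hc, sub_self, sin_zero, sub_zero]
  field_simp

theorem tendsto_div_sin {q : ℝ → ℝ} {q' c : ℝ} (hq : HasDerivAt q q' c) (hc : q c = 0) :
    Tendsto (fun x => q x / sin (x - c)) (𝓝[≠] c) (𝓝 q') := by
  have hs : HasDerivAt (fun x => sin (x - c)) 1 c := by
    simpa using (hasDerivAt_id c).sub_const c |>.sin
  have h1 := hasDerivAt_iff_tendsto_slope.1 hq
  have h2 := hasDerivAt_iff_tendsto_slope.1 hs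
  have h4 := h1.div h2 one_ne_zero
  rw [div_one] at h4
  refine h4.congr' ?_
  filter_upwards [self_mem_nhdsWithin] with x hx
  have hx : x - c ≠ 0 := sub_ne_zero.2 hx
  simp only [slope_def_field, Pi.div_apply, hc, sub_self, sin_zero, sub_zero]
  field_simp

/-- Wirtinger's inequality on an interval of length at most `π`, with a quantitative remainder. -/
theorem integral_remainder_le {q q₁ : ℝ → ℝ} (hq : ∀ x, HasDerivAt q (q₁ x) x)
    (hq₁ : Continuous q₁) {a b : ℝ} (hb : b ≤ a + π) (ha0 : q a = 0)
    (hb0 : q b = 0) {u v : ℝ} (hau : a < u) (huv : u ≤ v) (hvb : v < b) :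
    ∫ x in u..v, (q₁ x - q x * (cos (x - a) / sin (x - a))) ^ 2 ≤
      ∫ x in a..b, (q₁ x ^ 2 - q x ^ 2) := by
  have hqc : Continuous q := continuous_iff_continuousAt.2 fun x => (hq x).continuousAt
  have hab : a < b := hau.trans_le (huv.trans hvb.le)
  have hsin : ∀ x ∈ Set.Ioo a b, 0 < sin (x - a) := fun x hx =>
    sin_pos_of_pos_of_lt_pi (by linarith [hx.1]) (by linarith [hx.2])
  have hint : Continuous fun x => q₁ x ^ 2 - q x ^ 2 := by fun_prop
  -- With cotangent taken at x - a, F = q² cot is a primitive of q₁² - q² - (q₁ - q cot)². The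
  -- integral over [a, b] therefore dominates that of the square, once F is shown to vanish at both
  -- ends.
  set F : ℝ → ℝ := fun x => q x ^ 2 * (cos (x - a) / sin (x - a)) with hF
  set h : ℝ → ℝ := fun x => (q₁ x - q x * (cos (x - a) / sin (x - a))) ^ 2 with hh
  have hcont : ContinuousOn h (Set.Ioo a b) := by
    refine ContinuousOn.pow (hq₁.continuousOn.sub (hqc.continuousOn.mul ?_)) 2
    exact ContinuousOn.div (by fun_prop) (by fun_prop) fun x hx => (hsin x hx).ne'
  have hsub : ∀ {x y}, a < x → x ≤ y → y < b → Set.uIcc x y ⊆ Set.Ioo a b := by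
    intro x y h1 h2 h3 z hz
    rw [Set.uIcc_of_le h2] at hz
    exact ⟨h1.trans_le hz.1, hz.2.trans_lt h3⟩
  have hhint : ∀ {x y}, a < x → x ≤ y → y < b → IntervalIntegrable h volume x y :=
    fun h1 h2 h3 => (hcont.mono (hsub h1 h2 h3)).intervalIntegrable
  have key : ∀ x y, a < x → x ≤ y → y < b →
      (∫ z in x..y, (q₁ z ^ 2 - q z ^ 2)) - ∫ z in x..y, h z = F y - F x := by
    intro x y h1 h2 h3
    rw [← integral_sub (hint.intervalIntegrable _ _) (hhint h1 h2 h3)]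
    refine integral_eq_sub_of_hasDerivAt (fun z hz => ?_)
      ((hint.intervalIntegrable _ _).sub (hhint h1 h2 h3))
    have hs := (hsin z (hsub h1 h2 h3 hz)).ne'
    have hid := (hasDerivAt_id z).sub_const a
    have hd := ((hq z).pow 2).mul ((hid.cos).div hid.sin hs)
    refine hd.congr_deriv ?_
    simp only [hh, id]
    simp only [Pi.pow_apply, Pi.div_apply]
    field_simp
    ring
  have hFa : Tendsto F (𝓝[>] a) (𝓝 0) := by
    have h1 := (tendsto_sq_div_sin (hq a) ha0).mono_left (nhdsGT_le_nhdsNE a)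
    have h2 : Tendsto (fun x => cos (x - a)) (𝓝[>] a) (𝓝 (cos (a - a))) :=
      (Continuous.tendsto (by fun_prop) a).mono_left inf_le_left
    have h3 := h1.mul h2
    rw [zero_mul] at h3
    exact h3.congr fun x => by simp only [hF]; ring
  have hFb : Tendsto F (𝓝[<] b) (𝓝 0) := by
    have h2 : Tendsto (fun x => cos (x - a)) (𝓝[<] b) (𝓝 (cos (b - a))) :=
      (Continuous.tendsto (by fun_prop) b).mono_left inf_le_left
    -- If b < a + π the cotangent is finite at b. If b = a + π it has a pole there, absorbed by the
    -- double zero of q².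
    rcases hb.lt_or_eq with hb | hb
    · have hs : sin (b - a) ≠ 0 := (sin_pos_of_pos_of_lt_pi (by linarith) (by linarith)).ne'
      have h1 : Tendsto (fun x => sin (x - a)) (𝓝[<] b) (𝓝 (sin (b - a))) :=
        (Continuous.tendsto (by fun_prop) b).mono_left inf_le_left
      have h3 : Tendsto (fun x => q x ^ 2) (𝓝[<] b) (𝓝 (q b ^ 2)) :=
        (Continuous.tendsto (by fun_prop) b).mono_left inf_le_left
      have h4 := h3.mul (h2.div h1 hs)
      simpa [hb0] using h4
    · have h1 := (tendsto_sq_div_sin (hq b) hb0).mono_left (nhdsLT_le_nhdsNE b)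
      have h3 := (h1.mul h2).neg
      rw [zero_mul, neg_zero] at h3
      refine h3.congr fun x => ?_
      have : sin (x - b) = - sin (x - a) := by
        rw [hb, ← sin_sub_pi]; congr 1; ring
      simp only [hF, this, div_neg]
      ring
  have hprim : Continuous fun x => ∫ z in a..x, (q₁ z ^ 2 - q z ^ 2) :=
    continuous_primitive (fun _ _ => hint.intervalIntegrable _ _) a
  have hI : Tendsto (fun z : ℝ × ℝ => (∫ w in z.1..z.2, (q₁ w ^ 2 - q w ^ 2)) - (F z.2 - F z.1))
      (𝓝[>] a ×ˢ 𝓝[<] b) (𝓝 ((∫ z in a..b, (q₁ z ^ 2 - q z ^ 2)) - (0 - 0))) := by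
    refine Tendsto.sub ?_ ((hFb.comp tendsto_snd).sub (hFa.comp tendsto_fst))
    have h1 : Tendsto (fun z : ℝ × ℝ => (∫ w in a..z.2, (q₁ w ^ 2 - q w ^ 2)) -
        ∫ w in a..z.1, (q₁ w ^ 2 - q w ^ 2)) (𝓝[>] a ×ˢ 𝓝[<] b)
        (𝓝 ((∫ w in a..b, (q₁ w ^ 2 - q w ^ 2)) - ∫ w in a..a, (q₁ w ^ 2 - q w ^ 2))) :=
      (((hprim.tendsto b).mono_left inf_le_left).comp tendsto_snd).sub
        (((hprim.tendsto a).mono_left inf_le_left).comp tendsto_fst)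
    simp only [integral_same, sub_zero] at h1
    refine h1.congr fun z => ?_
    exact integral_interval_sub_left (hint.intervalIntegrable _ _) (hint.intervalIntegrable _ _)
  rw [sub_zero, sub_zero] at hI
  refine ge_of_tendsto hI ?_
  have e1 : ∀ᶠ x in 𝓝[>] a, x ∈ Set.Ioo a u := Ioo_mem_nhdsGT hau
  have e2 : ∀ᶠ y in 𝓝[<] b, y ∈ Set.Ioo v b := Ioo_mem_nhdsLT hvb
  filter_upwards [e1.prod_mk e2] with z hz
  obtain ⟨⟨h1, h2⟩, h3, h4⟩ := hz
  have hk := key z.1 z.2 h1 (by linarith) h4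
  have hm : ∫ w in u..v, h w ≤ ∫ w in z.1..z.2, h w :=
    integral_mono_interval h2.le huv h3.le (.of_forall fun x => sq_nonneg _)
      (hhint h1 (by linarith) h4)
  linarith

theorem wirtinger_interval {q q₁ : ℝ → ℝ} (hq : ∀ x, HasDerivAt q (q₁ x) x)
    (hq₁ : Continuous q₁) {a b : ℝ} (hab : a ≤ b) (hb : b ≤ a + π) (ha0 : q a = 0)
    (hb0 : q b = 0) : 0 ≤ ∫ x in a..b, (q₁ x ^ 2 - q x ^ 2) := by
  rcases hab.eq_or_lt with rfl | hab
  · simp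
  · have := integral_remainder_le hq hq₁ hb ha0 hb0 (u := (a + b) / 2) (v := (a + b) / 2)
      (by linarith) le_rfl (by linarith)
    simpa using this

/-- Without remainder, q₁ = q cot(x - a) inside the interval, so q = C sin(x - a). The constant C is
the derivative of q at a, which is zero. -/
theorem wirtinger_interval_eq {q q₁ : ℝ → ℝ} (hq : ∀ x, HasDerivAt q (q₁ x) x)
    (hq₁ : Continuous q₁) {a b : ℝ} (hb : b ≤ a + π) (ha0 : q a = 0)
    (hb0 : q b = 0) (ha1 : q₁ a = 0) (h : ∫ x in a..b, (q₁ x ^ 2 - q x ^ 2) ≤ 0) :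
    ∀ x ∈ Set.Icc a b, q x = 0 := by
  have hqc : Continuous q := continuous_iff_continuousAt.2 fun x => (hq x).continuousAt
  have hsin : ∀ x ∈ Set.Ioo a b, 0 < sin (x - a) := fun x hx =>
    sin_pos_of_pos_of_lt_pi (by linarith [hx.1]) (by linarith [hx.2])
  have hcont : ContinuousOn (fun x => (q₁ x - q x * (cos (x - a) / sin (x - a))) ^ 2)
      (Set.Ioo a b) := by
    refine ContinuousOn.pow (hq₁.continuousOn.sub (hqc.continuousOn.mul ?_)) 2
    exact ContinuousOn.div (by fun_prop) (by fun_prop) fun x hx => (hsin x hx).ne'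
  have hz : ∀ x ∈ Set.Ioo a b, q₁ x - q x * (cos (x - a) / sin (x - a)) = 0 := by
    intro x hx
    obtain ⟨v, hxv, hvb⟩ := exists_between hx.2
    have h1 := (integral_remainder_le hq hq₁ hb ha0 hb0 hx.1 hxv.le hvb).trans h
    by_contra hne
    have h2 := integral_pos hxv (hcont.mono fun z hz => ⟨hx.1.trans_le hz.1, hz.2.trans_lt hvb⟩)
      (fun _ _ => sq_nonneg _) ⟨x, ⟨le_rfl, hxv.le⟩, by positivity⟩
    linarith
  have hd : ∀ x ∈ Set.Ioo a b, HasDerivAt (fun x => q x / sin (x - a)) 0 x := by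
    intro x hx
    have hs := (hsin x hx).ne'
    refine ((hq x).div ((hasDerivAt_id x).sub_const a).sin hs).congr_deriv ?_
    have := hz x hx
    simp only [id] at *
    field_simp at this ⊢
    linear_combination this
  have hconst : ∀ x ∈ Set.Ioo a b, ∀ y ∈ Set.Ioo a b,
      q x / sin (x - a) = q y / sin (y - a) := by
    intro x hx y hy
    exact isOpen_Ioo.is_const_of_deriv_eq_zero isPreconnected_Ioo
      (fun z hz => (hd z hz).differentiableAt.differentiableWithinAt)
      (fun z hz => (hd z hz).deriv) hx hy
  have hzero : ∀ x ∈ Set.Ioo a b, q x = 0 := by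
    intro x hx
    have h1 := (tendsto_div_sin (hq a) ha0).mono_left (nhdsGT_le_nhdsNE a)
    have h2 : (fun y => q y / sin (y - a)) =ᶠ[𝓝[>] a] fun _ => q x / sin (x - a) := by
      filter_upwards [Ioo_mem_nhdsGT (hx.1.trans hx.2)] with y hy
      exact hconst y hy x hx
    have h3 := tendsto_nhds_unique (tendsto_const_nhds.congr' h2.symm) h1
    rw [ha1, div_eq_zero_iff] at h3
    exact h3.resolve_right (hsin x hx).ne'
  intro x hx
  rcases hx.1.eq_or_lt with rfl | h1
  · exact ha0
  rcases hx.2.eq_or_lt with rfl | h2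
  · exact hb0
  exact hzero x ⟨h1, h2⟩

/-- Starting from a zero t₀, take the last zero up to t₀ + π and the first zero from t₀ + π on. A
gap longer than π between these two would contain a closed half-period free of zeros. -/
theorem exists_zeros_of_arcs {q : ℝ → ℝ} (hqc : Continuous q)
    (hper : Function.Periodic q (2 * π))
    (harc : ∀ a, ∃ t ∈ Set.Icc a (a + π), q t = 0) :
    ∃ t₀ t₁ t₂, q t₀ = 0 ∧ q t₁ = 0 ∧ q t₂ = 0 ∧ t₀ ≤ t₁ ∧ t₁ ≤ t₂ ∧ t₂ ≤ t₀ + 2 * π ∧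
      t₁ ≤ t₀ + π ∧ t₂ ≤ t₁ + π ∧ t₀ + 2 * π ≤ t₂ + π := by
  have hZ : IsClosed {x | q x = 0} := isClosed_eq hqc continuous_const
  obtain ⟨t₀, -, h0⟩ := harc 0
  obtain ⟨t₁, ⟨⟨h1a, h1b⟩, h1⟩, h1max⟩ := ((isCompact_Icc (a := t₀) (b := t₀ + π)).inter_right
    hZ).exists_isGreatest ⟨t₀, ⟨le_rfl, by linarith [pi_pos]⟩, h0⟩
  obtain ⟨t₂, ⟨⟨h2a, h2b⟩, h2⟩, h2min⟩ := ((isCompact_Icc (a := t₀ + π)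
    (b := t₀ + 2 * π)).inter_right hZ).exists_isLeast
    ⟨t₀ + 2 * π, ⟨by linarith [pi_pos], le_rfl⟩, (hper t₀).trans h0⟩
  refine ⟨t₀, t₁, t₂, h0, h1, h2, h1a, h1b.trans h2a, h2b, h1b, ?_, by linarith⟩
  by_contra! hlt
  -- The half-period centred at the midpoint of the gap lies strictly between t₁ and t₂.
  obtain ⟨t, ⟨hta, htb⟩, ht⟩ := harc ((t₁ + t₂) / 2 - π / 2)
  rcases le_total t (t₀ + π) with h | h
  · have := h1max ⟨⟨by linarith, h⟩, ht⟩
    linarith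
  · have := h2min ⟨⟨h, by linarith⟩, ht⟩
    linarith

/-- Wirtinger's inequality for nonnegative periodic functions with a zero in each half-period. -/
theorem wirtinger_of_arcs {q q₁ : ℝ → ℝ} (hq : ∀ x, HasDerivAt q (q₁ x) x)
    (hq₁ : Continuous q₁) (hper : Function.Periodic q (2 * π)) (hnn : ∀ x, 0 ≤ q x)
    (harc : ∀ a, ∃ t ∈ Set.Icc a (a + π), q t = 0) :
    0 ≤ (∫ x in (0 : ℝ)..2 * π, (q₁ x ^ 2 - q x ^ 2)) ∧
      ((∫ x in (0 : ℝ)..2 * π, (q₁ x ^ 2 - q x ^ 2)) = 0 → ∀ x, q x = 0) := by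
  have hqc : Continuous q := continuous_iff_continuousAt.2 fun x => (hq x).continuousAt
  have hper1 := periodic_of_hasDerivAt hq hper
  have hint : Continuous fun x => q₁ x ^ 2 - q x ^ 2 := by fun_prop
  -- A zero of a nonnegative function is a minimum. The vanishing derivative is what rules out sine
  -- arches in the equality case.
  have hcrit : ∀ t, q t = 0 → q₁ t = 0 := fun t ht =>
    IsLocalMin.hasDerivAt_eq_zero (.of_forall fun x => by rw [ht]; exact hnn x) (hq t)
  obtain ⟨t₀, t₁, t₂, h0, h1, h2, l01, l12, l23, m01, m12, m23⟩ :=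
    exists_zeros_of_arcs hqc hper harc
  have h3 : q (t₀ + 2 * π) = 0 := (hper t₀).trans h0
  have w1 := wirtinger_interval hq hq₁ l01 m01 h0 h1
  have w2 := wirtinger_interval hq hq₁ l12 m12 h1 h2
  have w3 := wirtinger_interval hq hq₁ l23 m23 h2 h3
  have hsum : (∫ x in (0 : ℝ)..2 * π, (q₁ x ^ 2 - q x ^ 2)) =
      (∫ x in t₀..t₁, (q₁ x ^ 2 - q x ^ 2)) + (∫ x in t₁..t₂, (q₁ x ^ 2 - q x ^ 2)) +
        ∫ x in t₂..t₀ + 2 * π, (q₁ x ^ 2 - q x ^ 2) := by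
    rw [integral_add_adjacent_intervals (hint.intervalIntegrable _ _)
      (hint.intervalIntegrable _ _), integral_add_adjacent_intervals
      (hint.intervalIntegrable _ _) (hint.intervalIntegrable _ _)]
    have hp : Function.Periodic (fun x => q₁ x ^ 2 - q x ^ 2) (2 * π) := fun x => by
      simp only [hper x, hper1 x]
    simpa using hp.intervalIntegral_add_eq 0 t₀
  refine ⟨by linarith, fun he x => ?_⟩
  obtain ⟨y, ⟨hy0, hy1⟩, hy⟩ := hper.exists_mem_Ico two_pi_pos x t₀
  rw [hy]
  rcases le_total y t₁ with c1 | c1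
  · exact wirtinger_interval_eq hq hq₁ m01 h0 h1 (hcrit _ h0) (by linarith) y ⟨hy0, c1⟩
  rcases le_total y t₂ with c2 | c2
  · exact wirtinger_interval_eq hq hq₁ m12 h1 h2 (hcrit _ h1) (by linarith) y ⟨c1, c2⟩
  · exact wirtinger_interval_eq hq hq₁ m23 h2 h3 (hcrit _ h2) (by linarith) y ⟨c2, hy1.le⟩

/-! ### Support functions and supporting lines -/

theorem inner_normalDir (x : Plane) (θ : ℝ) :
    inner ℝ x (normalDir θ) = x 0 * cos θ + x 1 * sin θ := by
  simp [normalDir, PiLp.inner_apply, Fin.sum_univ_two, mul_comm]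

theorem norm_normalDir (θ : ℝ) : ‖normalDir θ‖ = 1 := by
  simp [normalDir, EuclideanSpace.norm_eq, Fin.sum_univ_two]

theorem exists_eq_norm_smul_normalDir (v : Plane) : ∃ θ, v = ‖v‖ • normalDir θ := by
  refine ⟨Complex.arg ⟨v 0, v 1⟩, ?_⟩
  have hn : ‖v‖ = ‖(⟨v 0, v 1⟩ : ℂ)‖ := by
    rw [EuclideanSpace.norm_eq, Complex.norm_def, Complex.normSq_mk, Fin.sum_univ_two]
    simp [sq]
  have h1 := Complex.norm_mul_cos_arg ⟨v 0, v 1⟩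
  have h2 := Complex.norm_mul_sin_arg ⟨v 0, v 1⟩
  rw [← hn] at h1 h2
  ext i
  fin_cases i
  · simpa [normalDir] using h1.symm
  · simpa [normalDir] using h2.symm

section Support

variable {K : Set Plane}

theorem inner_le_supportFun (hc : IsCompact K) {x : Plane} (hx : x ∈ K) (θ : ℝ) :
    inner ℝ x (normalDir θ) ≤ supportFun K θ :=
  le_csSup (hc.image (by fun_prop)).bddAbove ⟨x, hx, rfl⟩

theorem exists_inner_eq_supportFun (hc : IsCompact K) (hne : K.Nonempty) (θ : ℝ) :
    ∃ x ∈ K, inner ℝ x (normalDir θ) = supportFun K θ :=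
  (hc.image (by fun_prop : Continuous fun x : Plane => inner ℝ x (normalDir θ))).sSup_mem
    (hne.image _)

theorem exists_supportFun_lt_inner (hc : IsCompact K) (hconv : Convex ℝ K) (hne : K.Nonempty)
    {y : Plane} (hy : y ∉ K) : ∃ θ, supportFun K θ < inner ℝ y (normalDir θ) := by
  obtain ⟨f, u, h1, h2⟩ := geometric_hahn_banach_closed_point hconv hc.isClosed hy
  set v := (InnerProductSpace.toDual ℝ Plane).symm f with hv
  have hf : ∀ x, f x = inner ℝ x v := fun x => by
    rw [real_inner_comm, hv, InnerProductSpace.toDual_symm_apply]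
  obtain ⟨θ, hθ⟩ := exists_eq_norm_smul_normalDir v
  obtain ⟨x, hx, hxe⟩ := exists_inner_eq_supportFun hc hne θ
  refine ⟨θ, ?_⟩
  have h3 := (h1 x hx).trans h2
  rw [hf, hf, hθ, inner_smul_right, inner_smul_right, hxe] at h3
  exact lt_of_mul_lt_mul_left h3 (norm_nonneg v)

/-- Separating x from the open convex interior gives a supporting functional. It is nonzero because
the interior is nonempty, so it can be normalized to a direction. -/
theorem exists_inner_eq_of_mem_frontier (hc : IsCompact K) (hconv : Convex ℝ K)
    (hne : (interior K).Nonempty) {x : Plane} (hx : x ∈ frontier K) :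
    ∃ θ, inner ℝ x (normalDir θ) = supportFun K θ := by
  have hxK : x ∈ K := hc.isClosed.frontier_subset hx
  obtain ⟨f, hf⟩ := geometric_hahn_banach_open_point hconv.interior isOpen_interior hx.2
  have hle : ∀ a ∈ K, f a ≤ f x := by
    intro a ha
    have ha : a ∈ closure (interior K) := by
      rw [hconv.closure_interior_eq_closure_of_nonempty_interior hne]
      exact subset_closure ha
    exact closure_minimal (fun b hb => (hf b hb).le)
      (isClosed_le f.continuous continuous_const) ha
  set v := (InnerProductSpace.toDual ℝ Plane).symm f with hv
  have hfv : ∀ x, f x = inner ℝ x v := fun x => by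
    rw [real_inner_comm, hv, InnerProductSpace.toDual_symm_apply]
  obtain ⟨θ, hθ⟩ := exists_eq_norm_smul_normalDir v
  obtain ⟨a, ha⟩ := hne
  have hv0 : 0 < ‖v‖ := by
    rw [norm_pos_iff]
    intro h0
    have := hf a ha
    simp [hfv, h0] at this
  refine ⟨θ, le_antisymm (inner_le_supportFun hc hxK θ) ?_⟩
  obtain ⟨y, hy, hye⟩ := exists_inner_eq_supportFun hc ⟨x, hxK⟩ θ
  have h3 := hle y hy
  rw [hfv, hfv, hθ, inner_smul_right, inner_smul_right, hye] at h3
  exact le_of_mul_le_mul_left h3 hv0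

theorem supportFun_periodic (K : Set Plane) : Function.Periodic (supportFun K) (2 * π) := by
  intro θ
  simp [supportFun, normalDir]

end Support

/-! ### Normal angle and regularity of the support function -/

/-- A `2π`-lift of the normal angle of a regular curve of positive curvature. -/
structure NormalAngle (c : ℝ → Plane) (φ k s : ℝ → ℝ) : Prop where
  hasDerivAt : ∀ t, HasDerivAt φ (k t) t
  pos : ∀ t, 0 < k t
  speed_pos : ∀ t, 0 < s t
  deriv_fst : ∀ t, HasDerivAt (fun t => c t 0) (-(s t * sin (φ t))) t
  deriv_snd : ∀ t, HasDerivAt (fun t => c t 1) (s t * cos (φ t)) t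
  contDiff : ContDiff ℝ ∞ φ
  surjective : Function.Surjective φ

theorem hasDerivAt_coord {c : ℝ → Plane} {v : Plane} {t : ℝ} (h : HasDerivAt c v t) (i : Fin 2) :
    HasDerivAt (fun t => c t i) (v i) t :=
  (EuclideanSpace.proj (𝕜 := ℝ) i).hasFDerivAt.comp_hasDerivAt t h

/-- The lift is the integral of its expected derivative (x'y'' - y'x'')/(x'² + y'²), started at the
normal angle at time 0. -/
theorem exists_normalAngle {c : ℝ → Plane} {T : ℝ} (hT : 0 < T) (hc : ContDiff ℝ ∞ c)
    (hper : Function.Periodic c T) (hreg : ∀ t, deriv c t ≠ 0) (hcurv : ∀ t, 0 < curvature c t) :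
    ∃ φ k s, NormalAngle c φ k s := by
  have hc1 : ContDiff ℝ ∞ (deriv c) := (contDiff_infty_iff_deriv.1 hc).2
  have hc2 : ContDiff ℝ ∞ (deriv (deriv c)) := (contDiff_infty_iff_deriv.1 hc1).2
  have d1 : ∀ t, HasDerivAt c (deriv c t) t := fun t =>
    ((contDiff_infty_iff_deriv.1 hc).1 t).hasDerivAt
  have d2 : ∀ t, HasDerivAt (deriv c) (deriv (deriv c) t) t := fun t =>
    ((contDiff_infty_iff_deriv.1 hc1).1 t).hasDerivAt
  have hx1 : ContDiff ℝ ∞ fun t => deriv c t 0 :=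
    (EuclideanSpace.proj (𝕜 := ℝ) (0 : Fin 2)).contDiff.comp hc1
  have hy1 : ContDiff ℝ ∞ fun t => deriv c t 1 :=
    (EuclideanSpace.proj (𝕜 := ℝ) (1 : Fin 2)).contDiff.comp hc1
  have hx2 : ContDiff ℝ ∞ fun t => deriv (deriv c) t 0 :=
    (EuclideanSpace.proj (𝕜 := ℝ) (0 : Fin 2)).contDiff.comp hc2
  have hy2 : ContDiff ℝ ∞ fun t => deriv (deriv c) t 1 :=
    (EuclideanSpace.proj (𝕜 := ℝ) (1 : Fin 2)).contDiff.comp hc2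
  have dx1 := fun t => hasDerivAt_coord (d2 t) 0
  have dy1 := fun t => hasDerivAt_coord (d2 t) 1
  have p1 : Function.Periodic (deriv c) T := fun t => by
    have h := (d1 (t + T)).comp_add_const t T
    rw [show (fun t => c (t + T)) = c from funext hper] at h
    exact h.unique (d1 t)
  have p2 : Function.Periodic (deriv (deriv c)) T := fun t => by
    have h := (d2 (t + T)).comp_add_const t T
    rw [show (fun t => deriv c (t + T)) = deriv c from funext p1] at h
    exact h.unique (d2 t)
  set x₁ : ℝ → ℝ := fun t => deriv c t 0 with ex1
  set y₁ : ℝ → ℝ := fun t => deriv c t 1 with ey1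
  set x₂ : ℝ → ℝ := fun t => deriv (deriv c) t 0 with ex2
  set y₂ : ℝ → ℝ := fun t => deriv (deriv c) t 1 with ey2
  have hN : ∀ t, ‖deriv c t‖ ^ 2 = x₁ t ^ 2 + y₁ t ^ 2 := fun t => by
    rw [EuclideanSpace.norm_sq_eq, Fin.sum_univ_two]; simp [ex1, ey1]
  have hNpos : ∀ t, 0 < x₁ t ^ 2 + y₁ t ^ 2 := fun t => by
    rw [← hN]; have := norm_pos_iff.2 (hreg t); positivity
  have hw : ∀ t, 0 < x₁ t * y₂ t - y₁ t * x₂ t := fun t => by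
    have h3 : 0 < ‖deriv c t‖ ^ 3 := by have := norm_pos_iff.2 (hreg t); positivity
    have := mul_pos (hcurv t) h3
    rwa [curvature, div_mul_cancel₀ _ h3.ne'] at this
  set k : ℝ → ℝ := fun t => (x₁ t * y₂ t - y₁ t * x₂ t) / (x₁ t ^ 2 + y₁ t ^ 2) with hk
  have hkpos : ∀ t, 0 < k t := fun t => div_pos (hw t) (hNpos t)
  have hkc : ContDiff ℝ ∞ k := ((hx1.mul hy2).sub (hy1.mul hx2)).div
    ((hx1.pow 2).add (hy1.pow 2)) fun t => (hNpos t).ne'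
  have hkper : Function.Periodic k T := fun t => by simp only [hk, ex1, ey1, ex2, ey2, p1 t, p2 t]
  obtain ⟨φ₀, hφ₀⟩ := exists_eq_norm_smul_normalDir !₂[y₁ 0, -x₁ 0]
  have hn0 : ‖(!₂[y₁ 0, -x₁ 0] : Plane)‖ = √(x₁ 0 ^ 2 + y₁ 0 ^ 2) := by
    rw [EuclideanSpace.norm_eq, Fin.sum_univ_two]
    simp [add_comm]
  rw [hn0] at hφ₀
  have i1 : y₁ 0 = √(x₁ 0 ^ 2 + y₁ 0 ^ 2) * cos φ₀ := by
    simpa [normalDir] using congrArg (fun v : Plane => v 0) hφ₀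
  have i2 : -x₁ 0 = √(x₁ 0 ^ 2 + y₁ 0 ^ 2) * sin φ₀ := by
    simpa [normalDir] using congrArg (fun v : Plane => v 1) hφ₀
  set φ : ℝ → ℝ := fun t => φ₀ + ∫ z in (0 : ℝ)..t, k z with hφ
  have dφ : ∀ t, HasDerivAt φ (k t) t := fun t =>
    (hkc.continuous.integral_hasStrictDerivAt 0 t).hasDerivAt.const_add φ₀
  set s : ℝ → ℝ := fun t => √(x₁ t ^ 2 + y₁ t ^ 2) with hs
  have hspos : ∀ t, 0 < s t := fun t => sqrt_pos.2 (hNpos t)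
  have hssq : ∀ t, s t ^ 2 = x₁ t ^ 2 + y₁ t ^ 2 := fun t => sq_sqrt (hNpos t).le
  have ds : ∀ t, HasDerivAt s ((x₁ t * x₂ t + y₁ t * y₂ t) / s t) t := fun t => by
    refine ((((dx1 t).pow 2).add ((dy1 t).pow 2)).sqrt (hNpos t).ne').congr_deriv ?_
    have := (hspos t).ne'
    simp only [hs, ex1, ey1, ex2, ey2] at this ⊢
    simp only [Pi.add_apply, Pi.pow_apply]
    field_simp
    push_cast
    ring
  -- `hA` and `hB` say that the unit tangent has constant components in the frame rotating with φ.
  -- The initial choice of φ₀ makes these components 0 and 1.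
  have hA : ∀ t, HasDerivAt (fun t => (x₁ t * cos (φ t) + y₁ t * sin (φ t)) / s t) 0 t := fun t => by
    refine ((((dx1 t).mul (dφ t).cos).add ((dy1 t).mul (dφ t).sin)).div (ds t)
      (hspos t).ne').congr_deriv ?_
    have h1 := (hspos t).ne'
    have h2 := hssq t
    have h3 := (hNpos t).ne'
    change ((x₂ t * cos (φ t) + x₁ t * (-sin (φ t) * k t) + (y₂ t * sin (φ t) +
      y₁ t * (cos (φ t) * k t))) * s t - (x₁ t * cos (φ t) + y₁ t * sin (φ t)) *
      ((x₁ t * x₂ t + y₁ t * y₂ t) / s t)) / s t ^ 2 = 0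
    simp only [hk]
    rw [← h2]
    field_simp
    rw [h2]
    ring
  have hB : ∀ t, HasDerivAt (fun t => (-(x₁ t * sin (φ t)) + y₁ t * cos (φ t)) / s t) 0 t :=
      fun t => by
    refine (((((dx1 t).mul (dφ t).sin).neg).add ((dy1 t).mul (dφ t).cos)).div (ds t)
      (hspos t).ne').congr_deriv ?_
    have h1 := (hspos t).ne'
    have h2 := hssq t
    have h3 := (hNpos t).ne'
    change ((-(x₂ t * sin (φ t) + x₁ t * (cos (φ t) * k t)) + (y₂ t * cos (φ t) +
      y₁ t * (-sin (φ t) * k t))) * s t - (-(x₁ t * sin (φ t)) + y₁ t * cos (φ t)) *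
      ((x₁ t * x₂ t + y₁ t * y₂ t) / s t)) / s t ^ 2 = 0
    simp only [hk]
    rw [← h2]
    field_simp
    rw [h2]
    ring
  have hφ00 : φ 0 = φ₀ := by simp [hφ]
  have h0 := (hspos 0).ne'
  have hsc := sin_sq_add_cos_sq φ₀
  have i1' : y₁ 0 = s 0 * cos φ₀ := i1
  have i2' : x₁ 0 = -(s 0 * sin φ₀) := by rw [← neg_eq_iff_eq_neg]; exact i2
  have eA : ∀ t, x₁ t * cos (φ t) + y₁ t * sin (φ t) = 0 := fun t => by
    have h := is_const_of_deriv_eq_zero (fun t => (hA t).differentiableAt)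
      (fun t => (hA t).deriv) t 0
    simp only [hφ00, i1', i2'] at h
    rw [div_eq_iff (hspos t).ne'] at h
    rw [h]
    field_simp
    ring
  have eB : ∀ t, -(x₁ t * sin (φ t)) + y₁ t * cos (φ t) = s t := fun t => by
    have h := is_const_of_deriv_eq_zero (fun t => (hB t).differentiableAt)
      (fun t => (hB t).deriv) t 0
    simp only [hφ00, i1', i2'] at h
    rw [div_eq_iff (hspos t).ne'] at h
    rw [h]
    field_simp
    linear_combination (s t) * hsc
  have ex : ∀ t, x₁ t = -(s t * sin (φ t)) := fun t => by
    linear_combination cos (φ t) * eA t - sin (φ t) * eB t - x₁ t * sin_sq_add_cos_sq (φ t)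
  have ey : ∀ t, y₁ t = s t * cos (φ t) := fun t => by
    linear_combination sin (φ t) * eA t + cos (φ t) * eB t - y₁ t * sin_sq_add_cos_sq (φ t)
  refine ⟨φ, k, s, dφ, hkpos, hspos, fun t => ex t ▸ hasDerivAt_coord (d1 t) 0,
    fun t => ey t ▸ hasDerivAt_coord (d1 t) 1, ?_, ?_⟩
  · rw [contDiff_infty_iff_deriv, show deriv φ = k from funext fun t => (dφ t).deriv]
    exact ⟨fun t => (dφ t).differentiableAt, hkc⟩
  -- By periodicity k has a positive minimum, so φ grows at least linearly and is onto.
  · obtain ⟨t₀, -, ht₀⟩ := (isCompact_Icc (a := 0) (b := T)).exists_isMinOn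
      ⟨0, le_rfl, hT.le⟩ hkc.continuous.continuousOn
    have hmin : ∀ t, k t₀ ≤ k t := fun t => by
      obtain ⟨y, hy, hye⟩ := hkper.exists_mem_Ico₀ hT t
      rw [hye]
      exact ht₀ ⟨hy.1, hy.2.le⟩
    have hm : Monotone fun t => φ t - k t₀ * t := by
      refine monotone_of_deriv_nonneg (fun t => ?_) fun t => ?_
      · exact ((dφ t).sub ((hasDerivAt_id t).const_mul (k t₀))).differentiableAt
      · have h := ((dφ t).sub ((hasDerivAt_id t).const_mul (k t₀))).deriv
        have h2 := hmin t
        change 0 ≤ deriv (φ - fun y => k t₀ * id y) t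
        rw [h]
        linarith
    have hcont : Continuous φ := continuous_iff_continuousAt.2 fun t => (dφ t).continuousAt
    refine hcont.surjective ?_ ?_
    · refine tendsto_atTop_mono' _ (f₁ := fun t => φ 0 + k t₀ * t) ?_
        (tendsto_atTop_add_const_left _ _ (tendsto_id.const_mul_atTop (hkpos t₀)))
      filter_upwards [eventually_ge_atTop 0] with t ht
      have := hm ht
      simp only at this
      linarith
    · refine tendsto_atBot_mono' _ (f₁ := fun t => φ 0 + k t₀ * t) ?_
        (tendsto_atBot_add_const_left _ _ (tendsto_id.const_mul_atBot (hkpos t₀)))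
      filter_upwards [eventually_le_atBot 0] with t ht
      have := hm ht
      simp only at this
      linarith

namespace NormalAngle

variable {c : ℝ → Plane} {φ k s : ℝ → ℝ}

theorem strictMono (h : NormalAngle c φ k s) : StrictMono φ :=
  strictMono_of_deriv_pos fun t => by rw [(h.hasDerivAt t).deriv]; exact h.pos t

/-- At a maximum of the height in direction θ, the derivative s sin(θ - φ) vanishes, so φ = θ modulo
π. The opposite normal θ + π is excluded because the height would increase just after t. -/
theorem eq_add_of_isMax (h : NormalAngle c φ k s) {θ t : ℝ}
    (hmax : ∀ u, inner ℝ (c u) (normalDir θ) ≤ inner ℝ (c t) (normalDir θ)) :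
    ∃ n : ℤ, φ t = θ + n * (2 * π) := by
  have hd : ∀ u, HasDerivAt (fun u => inner ℝ (c u) (normalDir θ)) (s u * sin (θ - φ u)) u := by
    intro u
    simp only [inner_normalDir]
    refine (((h.deriv_fst u).mul_const (cos θ)).add
      ((h.deriv_snd u).mul_const (sin θ))).congr_deriv ?_
    rw [sin_sub]
    ring
  have h0 : s t * sin (θ - φ t) = 0 :=
    IsLocalMax.hasDerivAt_eq_zero (.of_forall hmax) (hd t)
  obtain ⟨n, hn⟩ := sin_eq_zero_iff.1 ((mul_eq_zero.1 h0).resolve_left (h.speed_pos t).ne')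
  rcases Int.even_or_odd' n with ⟨m, rfl | rfl⟩
  · refine ⟨-m, ?_⟩
    push_cast at hn ⊢
    linarith
  · exfalso
    have hcont : Continuous φ := h.contDiff.continuous
    have hev : ∀ᶠ u in 𝓝[>] t, φ u < φ t + π :=
      (hcont.tendsto t).mono_left inf_le_left |>.eventually (gt_mem_nhds (by linarith [pi_pos]))
    obtain ⟨u, hu, htu⟩ := (hev.and self_mem_nhdsWithin).exists
    have htu : t < u := htu
    have hm : StrictMonoOn (fun u => inner ℝ (c u) (normalDir θ)) (Set.Icc t u) := by
      refine strictMonoOn_of_deriv_pos (convex_Icc t u)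
        (fun v _ => (hd v).continuousAt.continuousWithinAt) fun v hv => ?_
      rw [interior_Icc] at hv
      rw [(hd v).deriv]
      refine mul_pos (h.speed_pos v) ?_
      have e : θ - φ v = π - (φ v - φ t) + m * (2 * π) := by
        push_cast at hn
        linarith
      rw [e, sin_add_int_mul_two_pi, sin_pi_sub]
      have h1 := h.strictMono hv.1
      have h2 := h.strictMono hv.2
      exact sin_pos_of_pos_of_lt_pi (by linarith) (by linarith)
    exact absurd (hm ⟨le_rfl, htu.le⟩ ⟨htu.le, le_rfl⟩ htu) (not_lt.2 (hmax u))

end NormalAngle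

/-- Regularity of the support function and of the normal-angle parametrization. -/
structure RegularBoundary (K : Set Plane) : Prop where
  contDiff : ContDiff ℝ ∞ (supportFun K)
  rho_pos : ∀ θ, 0 < supportFun K θ + deriv (deriv (supportFun K)) θ
  mem_frontier : ∀ θ, boundaryCurve K θ ∈ frontier K
  exists_eq : ∀ x ∈ frontier K, ∃ θ, boundaryCurve K θ = x
  inj : ∀ θ θ', boundaryCurve K θ = boundaryCurve K θ' → ∃ n : ℤ, θ' = θ + n * (2 * π)

theorem inner_boundaryCurve (K : Set Plane) (θ : ℝ) :
    inner ℝ (boundaryCurve K θ) (normalDir θ) = supportFun K θ := by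
  rw [inner_normalDir]
  simp only [boundaryCurve]
  have := sin_sq_add_cos_sq θ
  simp
  linear_combination supportFun K θ * this

theorem normalDir_add_int (θ : ℝ) (n : ℤ) : normalDir (θ + n * (2 * π)) = normalDir θ := by
  simp [normalDir, cos_add_int_mul_two_pi, sin_add_int_mul_two_pi]

/-- Positive curvature makes the normal angle a diffeomorphism of the line. Reparametrizing c by its
inverse ψ gives p = ⟨c ∘ ψ, n⟩, which is smooth, and p + p'' = s/k > 0 at ψ(θ). The curve built from
p and p' is then c ∘ ψ itself. -/
theorem IsSmoothStrictlyConvexDomain.regularBoundary {K : Set Plane}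
    (hK : IsSmoothStrictlyConvexDomain K) : RegularBoundary K := by
  obtain ⟨T, c, hT, hc, hper, -, hrange, hreg, hcurv⟩ := hK.smooth_boundary
  obtain ⟨φ, k, s, h⟩ := exists_normalAngle hT hc hper hreg hcurv
  have hcpt := hK.isCompact
  have hconv := hK.strictConvex.convex
  have hmemK : ∀ t, c t ∈ K := fun t =>
    hcpt.isClosed.frontier_subset (hrange ▸ Set.mem_range_self t)
  have hangle : ∀ {t θ}, inner ℝ (c t) (normalDir θ) = supportFun K θ →
      ∃ n : ℤ, φ t = θ + n * (2 * π) := fun {t θ} he =>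
    h.eq_add_of_isMax fun u => he ▸ inner_le_supportFun hcpt (hmemK u) θ
  have hsupp : ∀ t, supportFun K (φ t) = inner ℝ (c t) (normalDir (φ t)) := by
    intro t
    obtain ⟨θ, hθ⟩ := exists_inner_eq_of_mem_frontier hcpt hconv hK.nonempty_interior
      (hrange ▸ Set.mem_range_self t : c t ∈ frontier K)
    obtain ⟨n, hn⟩ := hangle hθ
    rw [hn, normalDir_add_int, hθ, supportFun, normalDir_add_int, supportFun]
  set Φ : ℝ ≃ₜ ℝ := (h.strictMono.orderIsoOfSurjective φ h.surjective).toHomeomorph with hΦ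
  have hΦφ : ∀ t, Φ t = φ t := fun _ => rfl
  have hψ : ContDiff ℝ ∞ Φ.symm :=
    Φ.contDiff_symm_deriv (fun t => (h.pos t).ne') h.hasDerivAt h.contDiff
  have hφψ : ∀ θ, φ (Φ.symm θ) = θ := fun θ => Φ.apply_symm_apply θ
  have hψφ : ∀ t, Φ.symm (φ t) = t := fun t => Φ.symm_apply_apply t
  have hψd : ∀ θ, HasDerivAt Φ.symm (k (Φ.symm θ))⁻¹ θ := fun θ =>
    HasDerivAt.of_local_left_inverse Φ.symm.continuous.continuousAt (h.hasDerivAt _)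
      (h.pos _).ne' (.of_forall hφψ)
  have hp : supportFun K = fun θ => c (Φ.symm θ) 0 * cos θ + c (Φ.symm θ) 1 * sin θ := by
    funext θ
    have := hsupp (Φ.symm θ)
    rwa [hφψ, inner_normalDir] at this
  have hc0 : ContDiff ℝ ∞ fun θ => c (Φ.symm θ) 0 :=
    (EuclideanSpace.proj (𝕜 := ℝ) (0 : Fin 2)).contDiff.comp (hc.comp hψ)
  have hc1 : ContDiff ℝ ∞ fun θ => c (Φ.symm θ) 1 :=
    (EuclideanSpace.proj (𝕜 := ℝ) (1 : Fin 2)).contDiff.comp (hc.comp hψ)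
  have e0 : ∀ θ, HasDerivAt (fun θ => c (Φ.symm θ) 0)
      (-(s (Φ.symm θ) * sin θ) * (k (Φ.symm θ))⁻¹) θ := fun θ => by
    have := (h.deriv_fst (Φ.symm θ)).comp θ (hψd θ)
    rwa [hφψ] at this
  have e1 : ∀ θ, HasDerivAt (fun θ => c (Φ.symm θ) 1)
      (s (Φ.symm θ) * cos θ * (k (Φ.symm θ))⁻¹) θ := fun θ => by
    have := (h.deriv_snd (Φ.symm θ)).comp θ (hψd θ)
    rwa [hφψ] at this
  have hp1 : deriv (supportFun K) = fun θ => -(c (Φ.symm θ) 0 * sin θ) + c (Φ.symm θ) 1 * cos θ := by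
    funext θ
    rw [hp]
    refine (((e0 θ).mul (hasDerivAt_cos θ)).add ((e1 θ).mul (hasDerivAt_sin θ))).deriv.trans ?_
    ring
  have hp2 : ∀ θ, supportFun K θ + deriv (deriv (supportFun K)) θ =
      s (Φ.symm θ) * (k (Φ.symm θ))⁻¹ := by
    intro θ
    rw [hp1]
    have := ((((e0 θ).mul (hasDerivAt_sin θ)).neg).add ((e1 θ).mul (hasDerivAt_cos θ))).deriv
    rw [hp]
    refine (congrArg _ this).trans ?_
    linear_combination (s (Φ.symm θ) * (k (Φ.symm θ))⁻¹) * sin_sq_add_cos_sq θ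
  have hb : ∀ θ, boundaryCurve K θ = c (Φ.symm θ) := by
    intro θ
    rw [boundaryCurve, hp1, hp]
    have := sin_sq_add_cos_sq θ
    ext i
    fin_cases i
    · simp
      linear_combination (c (Φ.symm θ) 0) * this
    · simp
      linear_combination (c (Φ.symm θ) 1) * this
  refine ⟨?_, fun θ => ?_, fun θ => ?_, fun x hx => ?_, fun θ θ' he => ?_⟩
  · rw [hp]
    exact (hc0.mul contDiff_cos).add (hc1.mul contDiff_sin)
  · rw [hp2]
    exact mul_pos (h.speed_pos _) (inv_pos.2 (h.pos _))
  · rw [hb, ← hrange]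
    exact Set.mem_range_self _
  · rw [← hrange] at hx
    obtain ⟨t, rfl⟩ := hx
    exact ⟨φ t, by rw [hb, hψφ]⟩
  · have h1 := inner_boundaryCurve K θ
    have h2 := inner_boundaryCurve K θ'
    rw [← he] at h2
    rw [hb] at h1 h2
    obtain ⟨n, hn⟩ := hangle h1
    obtain ⟨m, hm⟩ := hangle h2
    refine ⟨n - m, ?_⟩
    push_cast
    linarith

/-! ### Curvature, evolute and perimeter in the moving frame -/

/-- Unit tangent vector at normal angle `θ`. -/
def tangDir (θ : ℝ) : Plane := !₂[-sin θ, cos θ]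

theorem hasDerivAt_of_coord {f : ℝ → Plane} {v : Plane} {t : ℝ}
    (h0 : HasDerivAt (fun t => f t 0) (v 0) t) (h1 : HasDerivAt (fun t => f t 1) (v 1) t) :
    HasDerivAt f v t := by
  have h := (h0.smul_const (!₂[1, 0] : Plane)).add (h1.smul_const (!₂[0, 1] : Plane))
  have e : ∀ w : Plane, w = w 0 • (!₂[1, 0] : Plane) + w 1 • (!₂[0, 1] : Plane) := fun w => by
    ext i
    fin_cases i <;> simp
  rw [e v]
  exact h.congr_of_eventuallyEq (.of_forall fun x => e (f x))

theorem hasDerivAt_normalDir (θ : ℝ) : HasDerivAt normalDir (tangDir θ) θ :=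
  hasDerivAt_of_coord (by simpa [normalDir, tangDir] using hasDerivAt_cos θ)
    (by simpa [normalDir, tangDir] using hasDerivAt_sin θ)

theorem hasDerivAt_tangDir (θ : ℝ) : HasDerivAt tangDir (-normalDir θ) θ :=
  hasDerivAt_of_coord (by simpa [normalDir, tangDir] using (hasDerivAt_sin θ).fun_neg)
    (by simpa [normalDir, tangDir] using hasDerivAt_cos θ)

theorem norm_tangDir (θ : ℝ) : ‖tangDir θ‖ = 1 := by
  simp [tangDir, EuclideanSpace.norm_eq, Fin.sum_univ_two]

theorem curvature_of_deriv_tangDir {c : ℝ → Plane} {r r' : ℝ → ℝ}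
    (hc : ∀ θ, HasDerivAt c (r θ • tangDir θ) θ) (hr : ∀ θ, HasDerivAt r (r' θ) θ) (θ : ℝ) :
    curvature c θ = r θ ^ 2 / |r θ| ^ 3 := by
  have h1 : deriv c = fun θ => r θ • tangDir θ := funext fun θ => (hc θ).deriv
  have h2 : deriv (deriv c) θ = r θ • -normalDir θ + r' θ • tangDir θ := by
    rw [h1]
    exact ((hr θ).smul (hasDerivAt_tangDir θ)).deriv
  rw [curvature, h2, h1]
  simp only [norm_smul, norm_tangDir, mul_one, norm_eq_abs]
  congr 1
  simp [tangDir, normalDir]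
  linear_combination r θ ^ 2 * sin_sq_add_cos_sq θ

theorem curvature_of_deriv_normalDir {c : ℝ → Plane} {r r' : ℝ → ℝ}
    (hc : ∀ θ, HasDerivAt c (r θ • normalDir θ) θ) (hr : ∀ θ, HasDerivAt r (r' θ) θ) (θ : ℝ) :
    curvature c θ = r θ ^ 2 / |r θ| ^ 3 := by
  have h1 : deriv c = fun θ => r θ • normalDir θ := funext fun θ => (hc θ).deriv
  have h2 : deriv (deriv c) θ = r θ • tangDir θ + r' θ • normalDir θ := by
    rw [h1]
    exact ((hr θ).smul (hasDerivAt_normalDir θ)).deriv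
  rw [curvature, h2, h1]
  simp only [norm_smul, norm_normalDir, mul_one, norm_eq_abs]
  congr 1
  simp [tangDir, normalDir]
  linear_combination r θ ^ 2 * sin_sq_add_cos_sq θ

/-- The case x = 0 holds because division by zero gives 0. It covers the cusps of the evolute. -/
theorem one_div_sq_div_abs_cube (x : ℝ) : 1 / (x ^ 2 / |x| ^ 3) = |x| := by
  rcases eq_or_ne x 0 with rfl | hx
  · simp
  · rw [← sq_abs]
    have := abs_pos.2 hx
    field_simp

theorem boundaryCurve_eq (K : Set Plane) :
    boundaryCurve K = fun θ => supportFun K θ • normalDir θ + deriv (supportFun K) θ • tangDir θ := by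
  funext θ
  ext i
  fin_cases i <;> simp [boundaryCurve, normalDir, tangDir, sub_eq_add_neg]

theorem boundaryCurve_periodic (K : Set Plane) : Function.Periodic (boundaryCurve K) (2 * π) := by
  intro θ
  have h : deriv (supportFun K) (θ + 2 * π) = deriv (supportFun K) θ := by
    rw [← deriv_comp_add_const]
    congr 1
    exact funext (supportFun_periodic K)
  simp [boundaryCurve, h, supportFun_periodic K θ]

namespace RegularBoundary

variable {K : Set Plane}

theorem contDiff_iterate (h : RegularBoundary K) (n : ℕ) :
    ContDiff ℝ ∞ (deriv^[n] (supportFun K)) := by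
  induction n with
  | zero => exact h.contDiff
  | succ n ih =>
    rw [Function.iterate_succ_apply']
    exact (contDiff_infty_iff_deriv.1 ih).2

theorem hasDerivAt_iterate (h : RegularBoundary K) (n : ℕ) (θ : ℝ) :
    HasDerivAt (deriv^[n] (supportFun K)) (deriv^[n + 1] (supportFun K) θ) θ := by
  rw [Function.iterate_succ_apply']
  exact ((contDiff_infty_iff_deriv.1 (h.contDiff_iterate n)).1 θ).hasDerivAt

theorem periodicC3 (h : RegularBoundary K) : PeriodicC3 (supportFun K) (deriv (supportFun K))
    (deriv (deriv (supportFun K))) (deriv (deriv (deriv (supportFun K)))) where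
  d0 := h.hasDerivAt_iterate 0
  d1 := h.hasDerivAt_iterate 1
  d2 := h.hasDerivAt_iterate 2
  c3 := (h.contDiff_iterate 3).continuous
  per := supportFun_periodic K

theorem hasDerivAt_boundaryCurve (h : RegularBoundary K) (θ : ℝ) :
    HasDerivAt (boundaryCurve K)
      ((supportFun K θ + deriv (deriv (supportFun K)) θ) • tangDir θ) θ := by
  rw [boundaryCurve_eq]
  refine (((h.periodicC3.d0 θ).smul (hasDerivAt_normalDir θ)).add
    ((h.periodicC3.d1 θ).smul (hasDerivAt_tangDir θ))).congr_deriv ?_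
  module

theorem rho_eq (h : RegularBoundary K) :
    rho K = fun θ => supportFun K θ + deriv (deriv (supportFun K)) θ := by
  funext θ
  rw [rho, kappa, curvature_of_deriv_tangDir h.hasDerivAt_boundaryCurve
    (fun θ => (h.periodicC3.d0 θ).add (h.periodicC3.d2 θ)), one_div_sq_div_abs_cube,
    abs_of_pos (h.rho_pos θ)]

theorem centerLocus_eq (h : RegularBoundary K) : centerLocus K =
    fun θ => deriv (supportFun K) θ • tangDir θ - deriv (deriv (supportFun K)) θ • normalDir θ := by
  funext θ
  rw [centerLocus, h.rho_eq, boundaryCurve_eq]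
  module

theorem hasDerivAt_centerLocus (h : RegularBoundary K) (θ : ℝ) :
    HasDerivAt (centerLocus K)
      ((-(deriv (supportFun K) θ + deriv (deriv (deriv (supportFun K))) θ)) • normalDir θ) θ := by
  rw [h.centerLocus_eq]
  refine (((h.periodicC3.d1 θ).smul (hasDerivAt_tangDir θ)).sub
    ((h.periodicC3.d2 θ).smul (hasDerivAt_normalDir θ))).congr_deriv ?_
  module

theorem rhoBeta_eq (h : RegularBoundary K) :
    rhoBeta K = fun θ => |deriv (supportFun K) θ + deriv (deriv (deriv (supportFun K))) θ| := by
  funext θ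
  rw [rhoBeta, curvature_of_deriv_normalDir h.hasDerivAt_centerLocus
    (fun θ => ((h.periodicC3.d1 θ).add (h.hasDerivAt_iterate 3 θ)).neg), one_div_sq_div_abs_cube,
    abs_abs, abs_neg]

theorem areaTilde_eq (h : RegularBoundary K) : areaTilde K =
    1 / 2 * ∫ θ in (0 : ℝ)..2 * π, deriv (supportFun K) θ *
      (deriv (supportFun K) θ + deriv (deriv (deriv (supportFun K))) θ) := by
  rw [areaTilde, orientedArea]
  congr 1
  refine integral_congr fun θ _ => ?_
  simp only [(h.hasDerivAt_centerLocus θ).deriv]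
  rw [h.centerLocus_eq]
  simp [tangDir, normalDir]
  linear_combination (deriv (supportFun K) θ * (deriv (supportFun K) θ +
    deriv (deriv (deriv (supportFun K))) θ)) * sin_sq_add_cos_sq θ

theorem perimeter_eq (h : RegularBoundary K) :
    perimeter K = ∫ θ in (0 : ℝ)..2 * π, supportFun K θ := by
  rw [perimeter, ← h.periodicC3.integral_rho]
  refine integral_congr fun θ _ => ?_
  simp only [(h.hasDerivAt_boundaryCurve θ).deriv]
  rw [norm_smul, norm_tangDir, mul_one, norm_eq_abs, abs_of_pos (h.rho_pos θ)]

end RegularBoundary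

/-! ### The area formula in polar coordinates about an interior point -/

/-- The measurable identification of the plane with `ℝ × ℝ`. -/
def planeEquivProd : Plane ≃ᵐ ℝ × ℝ :=
  (MeasurableEquiv.toLp 2 (Fin 2 → ℝ)).symm.trans MeasurableEquiv.finTwoArrow

theorem planeEquivProd_apply (x : Plane) : planeEquivProd x = (x 0, x 1) := rfl

theorem measurePreserving_planeEquivProd : MeasurePreserving planeEquivProd :=
  (volume_preserving_finTwoArrow ℝ).comp (EuclideanSpace.volume_preserving_symm_measurableEquiv_toLp (Fin 2))

theorem volume_image_planeEquivProd (K : Set Plane) : volume (planeEquivProd '' K) = volume K := by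
  rw [← measurePreserving_planeEquivProd.measure_preimage_equiv,
    Set.preimage_image_eq _ planeEquivProd.injective]

section Area

variable {K : Set Plane}

/-- The radius s is the Minkowski gauge of K about x₀, and x - x₀ divided by s reaches the boundary.
The clause on s = 0 pins the angle of the pole, so that the pole falls in the null set of `area_eq`.
-/
theorem exists_eq_add_smul_boundaryCurve (hK : IsSmoothStrictlyConvexDomain K) {x₀ x : Plane}
    (hx₀ : x₀ ∈ interior K) (hx : x ∈ K) : ∃ s θ : ℝ, 0 ≤ s ∧ s ≤ 1 ∧ 0 ≤ θ ∧ θ < 2 * π ∧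
      (s = 0 → θ = 0) ∧ x = x₀ + s • (boundaryCurve K θ - x₀) := by
  have h := hK.regularBoundary
  rcases eq_or_ne x x₀ with rfl | hne
  · exact ⟨0, 0, le_rfl, zero_le_one, le_rfl, two_pi_pos, fun _ => rfl, by simp⟩
  set S : Set Plane := Homeomorph.addLeft x₀ ⁻¹' K with hS
  have hSc : Convex ℝ S := hK.strictConvex.convex.translate_preimage_right x₀
  have hcpt : IsCompact S := (Homeomorph.addLeft x₀).isCompact_preimage.2 hK.isCompact
  have hS0 : S ∈ 𝓝 (0 : Plane) := by
    refine (Homeomorph.addLeft x₀).continuous.continuousAt.preimage_mem_nhds ?_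
    simpa using mem_interior_iff_mem_nhds.1 hx₀
  have hpos : 0 < gauge S (x - x₀) := (gauge_pos (absorbent_nhds_zero hS0)
    ((NormedSpace.isVonNBounded_iff ℝ).2 hcpt.isBounded)).2 (sub_ne_zero.2 hne)
  set g := gauge S (x - x₀) with hg
  have hone : gauge S (g⁻¹ • (x - x₀)) = 1 := by
    rw [gauge_smul_of_nonneg (inv_nonneg.2 hpos.le), ← hg, smul_eq_mul, inv_mul_cancel₀ hpos.ne']
  rw [gauge_eq_one_iff_mem_frontier hSc hS0, hS, ← Homeomorph.preimage_frontier] at hone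
  obtain ⟨θ', hθ'⟩ := h.exists_eq _ hone
  obtain ⟨θ, hθ, hθe⟩ := (boundaryCurve_periodic K).exists_mem_Ico₀ two_pi_pos θ'
  refine ⟨g, θ, hpos.le, gauge_le_one_of_mem (by simpa [hS] using hx), hθ.1, hθ.2,
    fun h0 => absurd h0 hpos.ne', ?_⟩
  rw [← hθe, hθ']
  simp [smul_smul, mul_inv_cancel₀ hpos.ne']

theorem injOn_add_smul_boundaryCurve (hK : IsSmoothStrictlyConvexDomain K) {x₀ : Plane}
    (hx₀ : x₀ ∈ interior K) {s s' θ θ' : ℝ} (hs : 0 < s) (hs' : 0 < s')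
    (he : s • (boundaryCurve K θ - x₀) = s' • (boundaryCurve K θ' - x₀)) :
    s = s' ∧ boundaryCurve K θ = boundaryCurve K θ' := by
  have h := hK.regularBoundary
  set S : Set Plane := Homeomorph.addLeft x₀ ⁻¹' K with hS
  have hSc : Convex ℝ S := hK.strictConvex.convex.translate_preimage_right x₀
  have hS0 : S ∈ 𝓝 (0 : Plane) := by
    refine (Homeomorph.addLeft x₀).continuous.continuousAt.preimage_mem_nhds ?_
    simpa using mem_interior_iff_mem_nhds.1 hx₀
  have hone : ∀ θ, gauge S (boundaryCurve K θ - x₀) = 1 := fun θ => by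
    rw [gauge_eq_one_iff_mem_frontier hSc hS0, hS, ← Homeomorph.preimage_frontier]
    simpa using h.mem_frontier θ
  have hss : s = s' := by
    have := congrArg (gauge S) he
    rw [gauge_smul_of_nonneg hs.le, gauge_smul_of_nonneg hs'.le, hone, hone] at this
    simpa using this
  subst hss
  exact ⟨rfl, sub_left_injective (smul_right_injective _ hs.ne' he)⟩

/-- Change variables by (s, θ) ↦ x₀ + s(γ(θ) - x₀), whose Jacobian is s ρ (p - ⟨x₀, n⟩) ≥ 0. The x₀
term integrates to zero because γ is closed. -/
theorem area_eq (hK : IsSmoothStrictlyConvexDomain K) :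
    area K = 1 / 2 * ∫ θ in (0 : ℝ)..2 * π,
      supportFun K θ * (supportFun K θ + deriv (deriv (supportFun K)) θ) := by
  have h := hK.regularBoundary
  obtain ⟨x₀, hx₀⟩ := hK.nonempty_interior
  have hx₀K := interior_subset hx₀
  set r : ℝ → ℝ := fun θ => supportFun K θ + deriv (deriv (supportFun K)) θ with hr
  have hrc : Continuous r := h.periodicC3.c0.add h.periodicC3.c2
  have dX : ∀ θ, HasDerivAt (fun θ => boundaryCurve K θ 0) (-(r θ * sin θ)) θ := fun θ => by
    simpa [tangDir] using hasDerivAt_coord (h.hasDerivAt_boundaryCurve θ) 0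
  have dY : ∀ θ, HasDerivAt (fun θ => boundaryCurve K θ 1) (r θ * cos θ) θ := fun θ => by
    simpa [tangDir] using hasDerivAt_coord (h.hasDerivAt_boundaryCurve θ) 1
  set X : ℝ → ℝ := fun θ => boundaryCurve K θ 0 with hX
  set Y : ℝ → ℝ := fun θ => boundaryCurve K θ 1 with hY
  set f : ℝ × ℝ → ℝ × ℝ := fun z =>
    (x₀ 0 + z.1 * (X z.2 - x₀ 0), x₀ 1 + z.1 * (Y z.2 - x₀ 1)) with hf
  set f' : ℝ × ℝ → ℝ × ℝ →L[ℝ] ℝ × ℝ := fun z =>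
    (Matrix.toLin (.finTwoProd ℝ) (.finTwoProd ℝ) !![X z.2 - x₀ 0, z.1 * -(r z.2 * sin z.2);
      Y z.2 - x₀ 1, z.1 * (r z.2 * cos z.2)]).toContinuousLinearMap with hf'
  have hff' : ∀ z, HasFDerivAt f (f' z) z := by
    intro z
    simp only [hf']
    rw [Matrix.toLin_finTwoProd_toContinuousLinearMap]
    refine HasFDerivAt.congr_fderiv (HasFDerivAt.prodMk (𝕜 := ℝ)
      ((hasFDerivAt_fst.mul ((dX z.2).comp_hasFDerivAt z hasFDerivAt_snd |>.sub_const
        (x₀ 0))).const_add (x₀ 0))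
      ((hasFDerivAt_fst.mul ((dY z.2).comp_hasFDerivAt z hasFDerivAt_snd |>.sub_const
        (x₀ 1))).const_add (x₀ 1))) ?_
    ext <;> simp
  have hdet : ∀ z, (f' z).det =
      z.1 * (r z.2 * (supportFun K z.2 - (x₀ 0 * cos z.2 + x₀ 1 * sin z.2))) := by
    intro z
    have hp : supportFun K z.2 = X z.2 * cos z.2 + Y z.2 * sin z.2 := by
      rw [← inner_boundaryCurve, inner_normalDir]
    simp only [hf', LinearMap.det_toContinuousLinearMap, LinearMap.det_toLin,
      Matrix.det_fin_two_of]
    rw [hp]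
    ring
  have hfe : ∀ s θ, f (s, θ) = planeEquivProd (x₀ + s • (boundaryCurve K θ - x₀)) := fun s θ => by
    simp [hf, planeEquivProd_apply, hX, hY]
  set D : Set (ℝ × ℝ) := Set.Ioo 0 1 ×ˢ Set.Ioo 0 (2 * π) with hD
  -- The boundary s = 1 and the slit θ = 0 are what the open rectangle misses. Their image is null
  -- because f is differentiable.
  set N : Set (ℝ × ℝ) := {1} ×ˢ Set.univ ∪ Set.univ ×ˢ {0} with hN
  have hN0 : volume N = 0 := by
    rw [hN, measure_union_null_iff, Measure.volume_eq_prod, Measure.prod_prod, Measure.prod_prod]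
    simp
  have hfN : volume (f '' N) = 0 :=
    addHaar_image_eq_zero_of_differentiableOn_of_addHaar_eq_zero _
      (fun z _ => (hff' z).differentiableAt.differentiableWithinAt) hN0
  have hinj : Set.InjOn f D := by
    rintro ⟨s, θ⟩ ⟨⟨hs0, hs1⟩, hθ0, hθ1⟩ ⟨s', θ'⟩ ⟨⟨hs0', hs1'⟩, hθ0', hθ1'⟩ he
    simp only at hs0 hs1 hθ0 hθ1 hs0' hs1' hθ0' hθ1'
    rw [hfe, hfe] at he
    obtain ⟨rfl, hb⟩ := injOn_add_smul_boundaryCurve hK hx₀ hs0 hs0'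
      (add_right_injective _ (planeEquivProd.injective he))
    obtain ⟨n, hn⟩ := h.inj _ _ hb
    have h1 : (n : ℝ) < 1 := by by_contra! hc; nlinarith [pi_pos]
    have h2 : (-1 : ℝ) < n := by by_contra! hc; nlinarith [pi_pos]
    have h3 : n = 0 := by
      have : n < 1 := by exact_mod_cast h1
      have : -1 < n := by exact_mod_cast h2
      omega
    rw [hn, h3]
    simp
  have hsub1 : f '' D ⊆ planeEquivProd '' K := by
    rintro _ ⟨⟨s, θ⟩, ⟨⟨hs0, hs1⟩, -⟩, rfl⟩
    rw [hfe]
    refine Set.mem_image_of_mem _ ?_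
    exact hK.strictConvex.convex.add_smul_sub_mem hx₀K
      (hK.isCompact.isClosed.frontier_subset (h.mem_frontier θ)) ⟨hs0.le, hs1.le⟩
  have hsub2 : planeEquivProd '' K ⊆ f '' D ∪ f '' N := by
    rintro _ ⟨x, hx, rfl⟩
    obtain ⟨s, θ, hs0, hs1, hθ0, hθ1, hsθ, rfl⟩ := exists_eq_add_smul_boundaryCurve hK hx₀ hx
    rw [← hfe, ← Set.image_union]
    refine Set.mem_image_of_mem _ ?_
    rcases hθ0.eq_or_lt with rfl | hθ0
    · right; right; simp
    rcases hs1.eq_or_lt with rfl | hs1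
    · right; left; simp
    have hs0 : 0 < s := hs0.lt_of_ne fun h0 => hθ0.ne' (hsθ h0.symm)
    exact Or.inl ⟨⟨hs0, hs1⟩, hθ0, hθ1⟩
  have hvol : volume K = volume (f '' D) := by
    rw [← volume_image_planeEquivProd K]
    refine le_antisymm ?_ (measure_mono hsub1)
    calc volume (planeEquivProd '' K) ≤ volume (f '' D) + volume (f '' N) :=
          (measure_mono hsub2).trans (measure_union_le _ _)
      _ = volume (f '' D) := by rw [hfN, add_zero]
  have hDm : MeasurableSet D := measurableSet_Ioo.prod measurableSet_Ioo
  set w : ℝ → ℝ := fun θ => r θ * (supportFun K θ - (x₀ 0 * cos θ + x₀ 1 * sin θ)) with hw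
  have hw0 : ∀ θ, 0 ≤ w θ := fun θ => mul_nonneg (h.rho_pos θ).le (by
    have := inner_le_supportFun hK.isCompact hx₀K θ
    rw [inner_normalDir] at this
    linarith)
  have hA : area K = ∫ z in D, z.1 * w z.2 := by
    have h1 := integral_image_eq_integral_abs_det_fderiv_smul volume hDm
      (fun z _ => (hff' z).hasFDerivWithinAt) hinj (fun _ => (1 : ℝ))
    rw [area, hvol, ← Measure.real]
    simp only [MeasureTheory.integral_const, smul_eq_mul, mul_one, Measure.real,
      Measure.restrict_apply_univ] at h1
    rw [Measure.real, h1]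
    refine setIntegral_congr_fun hDm fun z hz => ?_
    simp only [hdet]
    exact abs_of_nonneg (mul_nonneg hz.1.1.le (hw0 z.2))
  rw [hA, hD, Measure.volume_eq_prod, setIntegral_prod_mul (fun s : ℝ => s) w,
    ← integral_Ioc_eq_integral_Ioo, ← integral_Ioc_eq_integral_Ioo,
    ← intervalIntegral.integral_of_le zero_le_one, ← intervalIntegral.integral_of_le two_pi_pos.le,
    integral_id]
  norm_num
  have hpc := h.periodicC3.c0
  -- The integrals of ρ sin and ρ cos are, up to sign, the increments of the coordinates of γ over a
  -- full turn.
  have z1 : ∫ θ in (0 : ℝ)..2 * π, r θ * sin θ = 0 := by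
    have := integral_eq_sub_of_hasDerivAt (a := 0) (b := 2 * π) (fun θ _ => dX θ)
      (Continuous.intervalIntegrable (by fun_prop) _ _)
    rw [intervalIntegral.integral_neg] at this
    have e : X (2 * π) = X 0 := by
      have := boundaryCurve_periodic K 0
      rw [zero_add] at this
      simp only [hX, this]
    linarith
  have z2 : ∫ θ in (0 : ℝ)..2 * π, r θ * cos θ = 0 := by
    have := integral_eq_sub_of_hasDerivAt (a := 0) (b := 2 * π) (fun θ _ => dY θ)
      (Continuous.intervalIntegrable (by fun_prop) _ _)
    have e : Y (2 * π) = Y 0 := by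
      have := boundaryCurve_periodic K 0
      rw [zero_add] at this
      simp only [hY, this]
    linarith
  have hsplit : ∀ θ, w θ = supportFun K θ * r θ - (x₀ 0 * (r θ * cos θ) + x₀ 1 * (r θ * sin θ)) :=
    fun θ => by simp only [hw]; ring
  simp only [hsplit]
  rw [intervalIntegral.integral_sub, intervalIntegral.integral_add,
    intervalIntegral.integral_const_mul, intervalIntegral.integral_const_mul, z1, z2]
  · simp [hr]
  all_goals
    apply Continuous.intervalIntegrable
    fun_prop

end Area

/-! ### Optimal circumscribed and inscribed circles -/

theorem continuous_normalDir : Continuous normalDir :=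
  continuous_iff_continuousAt.2 fun θ => (hasDerivAt_normalDir θ).continuousAt

theorem normalDir_periodic : Function.Periodic normalDir (2 * π) := fun θ => by
  simp [normalDir]

theorem exists_pos_le_of_periodic {f : ℝ → ℝ} (hf : Continuous f)
    (hper : Function.Periodic f (2 * π)) (hpos : ∀ θ, 0 < f θ) : ∃ ε > 0, ∀ θ, ε ≤ f θ := by
  obtain ⟨t, -, ht⟩ := (isCompact_Icc (a := 0) (b := 2 * π)).exists_isMinOn
    ⟨0, le_rfl, two_pi_pos.le⟩ hf.continuousOn
  refine ⟨f t, hpos t, fun θ => ?_⟩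
  obtain ⟨y, hy, hye⟩ := hper.exists_mem_Ico₀ two_pi_pos θ
  rw [hye]
  exact ht ⟨hy.1, hy.2.le⟩

/-- If the gap q stayed positive on a closed half-turn, a small translation towards the middle of
that arc would make it positive everywhere, against optimality. -/
theorem exists_zero_of_optimal {q : ℝ → ℝ} (hq : Continuous q)
    (hper : Function.Periodic q (2 * π)) (hnn : ∀ θ, 0 ≤ q θ)
    (hopt : ∀ v : Plane, ∃ θ, q θ - inner ℝ v (normalDir θ) ≤ 0) (a : ℝ) :
    ∃ t ∈ Set.Icc a (a + π), q t = 0 := by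
  by_contra! hne
  obtain ⟨t, ht, hmin⟩ := (isCompact_Icc (a := a) (b := a + π)).exists_isMinOn
    ⟨a, le_rfl, by linarith [pi_pos]⟩ hq.continuousOn
  have hε : 0 < q t := (hnn t).lt_of_ne (hne t ht).symm
  -- Half the minimum of q on the arc is short enough there; off the arc the cosine is negative, so
  -- the translation only enlarges the gap.
  obtain ⟨θ, hθ⟩ := hopt ((q t / 2) • normalDir (a + π / 2))
  obtain ⟨y, ⟨hy0, hy1⟩, hye⟩ := (hper.sub fun θ => by
    rw [normalDir_periodic θ] : Function.Periodic
      (q - fun θ => inner ℝ ((q t / 2) • normalDir (a + π / 2)) (normalDir θ))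
      (2 * π)).exists_mem_Ico two_pi_pos θ a
  have hy : q y - inner ℝ ((q t / 2) • normalDir (a + π / 2)) (normalDir y) ≤ 0 :=
    hye.symm.trans_le hθ
  have hcos : inner ℝ ((q t / 2) • normalDir (a + π / 2)) (normalDir y) =
      q t / 2 * cos (y - (a + π / 2)) := by
    have h0 : normalDir (a + π / 2) 0 = cos (a + π / 2) := rfl
    have h1 : normalDir (a + π / 2) 1 = sin (a + π / 2) := rfl
    rw [inner_smul_left, inner_normalDir, cos_sub, h0, h1, conj_trivial]
    ring
  rw [hcos] at hy
  rcases le_or_gt y (a + π) with h | h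
  · have h1 : q t ≤ q y := hmin ⟨hy0, h⟩
    have h2 := cos_le_one (y - (a + π / 2))
    nlinarith
  · have h2 := cos_neg_of_pi_div_two_lt_of_lt (x := y - (a + π / 2)) (by linarith) (by linarith)
    have h3 := hnn y
    nlinarith

section Radii

variable {K : Set Plane}

theorem subset_closedBall_iff (hc : IsCompact K) (hne : K.Nonempty) {x : Plane} {r : ℝ} :
    K ⊆ Metric.closedBall x r ↔ ∀ θ, supportFun K θ - inner ℝ x (normalDir θ) ≤ r := by
  constructor
  · intro h θ
    obtain ⟨y, hy, hye⟩ := exists_inner_eq_supportFun hc hne θ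
    rw [← hye, ← inner_sub_left]
    have h1 := real_inner_le_norm (y - x) (normalDir θ)
    rw [norm_normalDir, mul_one, ← dist_eq_norm] at h1
    exact h1.trans (h hy)
  · intro h y hy
    obtain ⟨θ, hθ⟩ := exists_eq_norm_smul_normalDir (y - x)
    have h1 : inner ℝ (y - x) (normalDir θ) = ‖y - x‖ := by
      conv_lhs => rw [hθ, inner_smul_left, real_inner_self_eq_norm_sq, norm_normalDir]
      simp
    rw [Metric.mem_closedBall, dist_eq_norm, ← h1, inner_sub_left]
    exact (sub_le_sub_right (inner_le_supportFun hc hy θ) _).trans (h θ)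

theorem closedBall_subset_iff (hc : IsCompact K) (hconv : Convex ℝ K) (hne : K.Nonempty)
    {x : Plane} {r : ℝ} (hr : 0 ≤ r) :
    Metric.closedBall x r ⊆ K ↔ ∀ θ, r ≤ supportFun K θ - inner ℝ x (normalDir θ) := by
  constructor
  · intro h θ
    have hm : x + r • normalDir θ ∈ K := h (by
      simp [norm_smul, norm_normalDir, abs_of_nonneg hr])
    have := inner_le_supportFun hc hm θ
    rw [inner_add_left, inner_smul_left, real_inner_self_eq_norm_sq, norm_normalDir] at this
    simp at this
    linarith
  · intro h y hy
    by_contra hyK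
    obtain ⟨θ, hθ⟩ := exists_supportFun_lt_inner hc hconv hne hyK
    have h1 := real_inner_le_norm (y - x) (normalDir θ)
    rw [norm_normalDir, mul_one, ← dist_eq_norm, inner_sub_left] at h1
    have h2 := Metric.mem_closedBall.1 hy
    have h3 := h θ
    linarith

/-- A least radius is attained by compactness. If translating the centre by -v made the gap positive
for all θ, periodicity would bound it below by some ε > 0 and a disk of radius R - ε would suffice.
-/
theorem exists_circumcenter (hc : IsCompact K) (hne : K.Nonempty)
    (hp : Continuous (supportFun K)) : ∃ x : Plane,
    (∀ θ, supportFun K θ - inner ℝ x (normalDir θ) ≤ circumradius K) ∧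
    ∀ v : Plane, ∃ θ, circumradius K - supportFun K θ + inner ℝ x (normalDir θ) -
      inner ℝ v (normalDir θ) ≤ 0 := by
  obtain ⟨M, hM⟩ := hc.isBounded.subset_closedBall (0 : Plane)
  obtain ⟨y, hy⟩ := hne
  have hyM : ‖y‖ ≤ M := by simpa using hM hy
  have hM0 : 0 ≤ M := (norm_nonneg y).trans hyM
  -- Only radii up to M compete. A disk of such radius contains y with ‖y‖ ≤ M, so its centre has
  -- norm at most 2M.
  set C : Set (Plane × ℝ) := (Metric.closedBall 0 (2 * M) ×ˢ Set.Icc 0 M) ∩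
    {z | ∀ θ, supportFun K θ - inner ℝ z.1 (normalDir θ) ≤ z.2} with hC
  have hCc : IsCompact C := by
    refine ((isCompact_closedBall _ _).prod isCompact_Icc).inter_right ?_
    simp only [Set.ofPred_forall]
    exact isClosed_iInter fun θ => isClosed_le (by fun_prop) (by fun_prop)
  have hCne : C.Nonempty := ⟨(0, M), ⟨by simp [hM0], hM0, le_rfl⟩,
    (subset_closedBall_iff hc ⟨y, hy⟩).1 hM⟩
  obtain ⟨⟨x, R⟩, ⟨⟨-, hR0, hRM⟩, hxR⟩, hmin⟩ := hCc.exists_isMinOn hCne continuous_snd.continuousOn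
  have hleast : IsLeast {r : ℝ | 0 ≤ r ∧ ∃ x : Plane, K ⊆ Metric.closedBall x r} R := by
    refine ⟨⟨hR0, x, (subset_closedBall_iff hc ⟨y, hy⟩).2 hxR⟩, ?_⟩
    rintro r ⟨hr0, x', hx'⟩
    rcases le_total r M with h | h
    · have h1 : dist y x' ≤ r := hx' hy
      have h2 : ‖x'‖ ≤ 2 * M := by
        have := norm_le_norm_add_norm_sub y x'
        rw [dist_eq_norm] at h1
        linarith
      exact hmin (a := (x', r)) ⟨⟨by simpa using h2, hr0, h⟩,
        (subset_closedBall_iff hc ⟨y, hy⟩).1 hx'⟩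
    · exact hRM.trans h
  have hRe : circumradius K = R := hleast.csInf_eq
  rw [hRe]
  refine ⟨x, hxR, fun v => ?_⟩
  by_contra! hpos
  obtain ⟨ε, hε, hle⟩ := exists_pos_le_of_periodic (f := fun θ => R - supportFun K θ +
    inner ℝ x (normalDir θ) - inner ℝ v (normalDir θ))
    (by have := continuous_normalDir; fun_prop)
    (fun θ => by simp only [supportFun_periodic K θ, normalDir_periodic θ]) hpos
  have hsub : K ⊆ Metric.closedBall (x - v) (R - ε) :=
    (subset_closedBall_iff hc ⟨y, hy⟩).2 fun θ => by
      have := hle θ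
      rw [inner_sub_left]
      linarith
  have h0 : 0 ≤ R - ε := dist_nonneg.trans (hsub hy)
  have := hleast.2 ⟨h0, _, hsub⟩
  linarith

theorem exists_incenter (hc : IsCompact K) (hconv : Convex ℝ K) (hne : (interior K).Nonempty)
    (hp : Continuous (supportFun K)) : 0 < inradius K ∧ ∃ x : Plane,
    (∀ θ, inradius K ≤ supportFun K θ - inner ℝ x (normalDir θ)) ∧
    ∀ v : Plane, ∃ θ, supportFun K θ - inner ℝ x (normalDir θ) - inradius K -
      inner ℝ v (normalDir θ) ≤ 0 := by
  have hneK : K.Nonempty := hne.mono interior_subset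
  obtain ⟨M, hM⟩ := hc.isBounded.subset_closedBall (0 : Plane)
  obtain ⟨y, hy⟩ := hne
  obtain ⟨ε₀, hε₀, hball⟩ := Metric.nhds_basis_closedBall.mem_iff.1 (mem_interior_iff_mem_nhds.1 hy)
  have hbd : ∀ {r x}, 0 ≤ r → Metric.closedBall x r ⊆ K → r ≤ 2 * M := fun {r x} hr hx => by
    have hxK := hx (Metric.mem_closedBall_self hr)
    have h1 := (closedBall_subset_iff hc hconv hneK hr).1 hx 0
    have h2 := (subset_closedBall_iff hc hneK).1 hM 0
    have h3 := neg_le_of_abs_le (abs_real_inner_le_norm x (normalDir 0))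
    have h4 : ‖x‖ ≤ M := by simpa using hM hxK
    rw [norm_normalDir, mul_one] at h3
    simp only [inner_zero_left, sub_zero] at h2
    linarith
  set C : Set (Plane × ℝ) := (K ×ˢ Set.Icc 0 (2 * M)) ∩
    {z | ∀ θ, z.2 ≤ supportFun K θ - inner ℝ z.1 (normalDir θ)} with hC
  have hCc : IsCompact C := by
    refine (hc.prod isCompact_Icc).inter_right ?_
    simp only [Set.ofPred_forall]
    exact isClosed_iInter fun θ => isClosed_le (by fun_prop) (by fun_prop)
  have hmem : ∀ {r x}, 0 ≤ r → Metric.closedBall x r ⊆ K → (x, r) ∈ C := fun {r x} hr hx =>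
    ⟨⟨hx (Metric.mem_closedBall_self hr), hr, hbd hr hx⟩,
      (closedBall_subset_iff hc hconv hneK hr).1 hx⟩
  obtain ⟨⟨x, r⟩, ⟨⟨-, hr0, hrM⟩, hxr⟩, hmax⟩ := hCc.exists_isMaxOn ⟨_, hmem hε₀.le hball⟩
    continuous_snd.continuousOn
  have hgreat : IsGreatest {r : ℝ | 0 ≤ r ∧ ∃ x : Plane, Metric.closedBall x r ⊆ K} r := by
    refine ⟨⟨hr0, x, (closedBall_subset_iff hc hconv hneK hr0).2 hxr⟩, ?_⟩
    rintro r' ⟨hr0', x', hx'⟩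
    exact hmax (hmem hr0' hx')
  have hre : inradius K = r := hgreat.csSup_eq
  rw [hre]
  refine ⟨hε₀.trans_le (hgreat.2 ⟨hε₀.le, y, hball⟩), x, hxr, fun v => ?_⟩
  by_contra! hpos
  obtain ⟨ε, hε, hle⟩ := exists_pos_le_of_periodic (f := fun θ => supportFun K θ -
    inner ℝ x (normalDir θ) - r - inner ℝ v (normalDir θ))
    (by have := continuous_normalDir; fun_prop)
    (fun θ => by simp only [supportFun_periodic K θ, normalDir_periodic θ]) hpos
  have hsub : Metric.closedBall (x + v) (r + ε) ⊆ K :=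
    (closedBall_subset_iff hc hconv hneK (by linarith)).2 fun θ => by
      have := hle θ
      rw [inner_add_left]
      linarith
  have := hgreat.2 ⟨by linarith, _, hsub⟩
  linarith

theorem supportFun_closedBall (x : Plane) {r : ℝ} (hr : 0 ≤ r) (θ : ℝ) :
    supportFun (Metric.closedBall x r) θ = r + inner ℝ x (normalDir θ) := by
  have hc : IsCompact (Metric.closedBall x r) := isCompact_closedBall x r
  have hne : (Metric.closedBall x r).Nonempty := ⟨x, Metric.mem_closedBall_self hr⟩
  have h1 := (subset_closedBall_iff hc hne).1 le_rfl θ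
  have h2 := (closedBall_subset_iff hc (convex_closedBall x r) hne hr).1 le_rfl θ
  linarith

end Radii

/-! ### Bonnesen's and Bottema's inequalities -/

theorem hasDerivAt_inner_normalDir (x : Plane) (θ : ℝ) :
    HasDerivAt (fun θ => inner ℝ x (normalDir θ)) (inner ℝ x (tangDir θ)) θ := by
  simpa using (hasDerivAt_const θ x).inner ℝ (hasDerivAt_normalDir θ)

theorem hasDerivAt_inner_tangDir (x : Plane) (θ : ℝ) :
    HasDerivAt (fun θ => inner ℝ x (tangDir θ)) (-inner ℝ x (normalDir θ)) θ := by
  simpa using (hasDerivAt_const θ x).inner ℝ (hasDerivAt_tangDir θ)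

theorem continuous_tangDir : Continuous tangDir :=
  continuous_iff_continuousAt.2 fun θ => (hasDerivAt_tangDir θ).continuousAt

theorem inner_normalDir_periodic (x : Plane) :
    Function.Periodic (fun θ => inner ℝ x (normalDir θ)) (2 * π) := fun θ => by
  simp only [normalDir_periodic θ]

namespace PeriodicC3

variable {p p₁ p₂ p₃ : ℝ → ℝ}

theorem integral_inner_normalDir (x : Plane) :
    ∫ θ in (0 : ℝ)..2 * π, inner ℝ x (normalDir θ) = 0 := by
  have hn := continuous_normalDir
  have h := integral_eq_sub_of_hasDerivAt (a := 0) (b := 2 * π)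
    (fun θ _ => hasDerivAt_inner_tangDir x θ) (Continuous.intervalIntegrable (by fun_prop) _ _)
  have h2 := (periodic_of_hasDerivAt (hasDerivAt_inner_normalDir x) (inner_normalDir_periodic x)) 0
  rw [zero_add] at h2
  rw [intervalIntegral.integral_neg, h2] at h
  linarith

theorem integral_inner_normalDir_mul_rho (h : PeriodicC3 p p₁ p₂ p₃) (x : Plane) :
    ∫ θ in (0 : ℝ)..2 * π, inner ℝ x (normalDir θ) * (p θ + p₂ θ) = 0 := by
  have hn := continuous_normalDir
  have ht := continuous_tangDir
  have c0 := h.c0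
  have c2 := h.c2
  have hper := inner_normalDir_periodic x
  have e1 := integral_mul_deriv_neg (hasDerivAt_inner_normalDir x) h.d1 (by fun_prop) h.c2 hper h.per1
  have e2 := integral_mul_deriv_neg (hasDerivAt_inner_tangDir x) h.d0 (by fun_prop) h.c1
    (periodic_of_hasDerivAt (hasDerivAt_inner_normalDir x) hper) h.per
  simp only [mul_add]
  rw [intervalIntegral.integral_add (Continuous.intervalIntegrable (by fun_prop) _ _)
    (Continuous.intervalIntegrable (by fun_prop) _ _), e1, e2]
  simp

/-- The deficit does not see the translation by x. Subtracting r changes only the mean, whose square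
must then be taken off again. This turns Wirtinger's inequality for the gap into a bound on (L -
2πr)². -/
theorem integral_sq_sub_sq (h : PeriodicC3 p p₁ p₂ p₃) (x : Plane) (r : ℝ) :
    ∫ θ in (0 : ℝ)..2 * π, ((p₁ θ - inner ℝ x (tangDir θ)) ^ 2 -
      (p θ - inner ℝ x (normalDir θ) - r) ^ 2) =
    deficit p p₁ - ((∫ θ in (0 : ℝ)..2 * π, p θ) - 2 * π * r) ^ 2 / (2 * π) := by
  have hn := continuous_normalDir
  have ht := continuous_tangDir
  have c0 := h.c0
  have c1 := h.c1
  have c2 := h.c2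
  have hper := inner_normalDir_periodic x
  have d0 : ∀ θ, HasDerivAt (fun θ => p θ - inner ℝ x (normalDir θ) - r)
      (p₁ θ - inner ℝ x (tangDir θ)) θ := fun θ =>
    ((h.d0 θ).sub (hasDerivAt_inner_normalDir x θ)).sub_const r
  have d1 : ∀ θ, HasDerivAt (fun θ => p₁ θ - inner ℝ x (tangDir θ))
      (p₂ θ + inner ℝ x (normalDir θ)) θ := fun θ =>
    ((h.d1 θ).sub (hasDerivAt_inner_tangDir x θ)).congr_deriv (by ring)
  have hper0 : Function.Periodic (fun θ => p θ - inner ℝ x (normalDir θ) - r) (2 * π) :=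
    fun θ => by simp only [h.per θ, normalDir_periodic θ]
  have parts := integral_mul_deriv_neg d0 d1 (by fun_prop) (by fun_prop) hper0
    (periodic_of_hasDerivAt d0 hper0)
  have e1 : ∫ θ in (0 : ℝ)..2 * π, ((p₁ θ - inner ℝ x (tangDir θ)) ^ 2 -
      (p θ - inner ℝ x (normalDir θ) - r) ^ 2) =
      -∫ θ in (0 : ℝ)..2 * π, (p θ - inner ℝ x (normalDir θ) - r) * (p θ + p₂ θ - r) := by
    have : ∀ θ, (p θ - inner ℝ x (normalDir θ) - r) * (p θ + p₂ θ - r) =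
        (p θ - inner ℝ x (normalDir θ) - r) * (p₂ θ + inner ℝ x (normalDir θ)) +
        (p θ - inner ℝ x (normalDir θ) - r) ^ 2 := fun θ => by ring
    simp only [this]
    rw [intervalIntegral.integral_add, intervalIntegral.integral_sub, parts]
    · simp only [← sq]
      ring
    all_goals
      apply Continuous.intervalIntegrable
      fun_prop
  have e2 : ∀ θ, (p θ - inner ℝ x (normalDir θ) - r) * (p θ + p₂ θ - r) =
      p θ * (p θ + p₂ θ) - inner ℝ x (normalDir θ) * (p θ + p₂ θ) - r * (p θ + p₂ θ) - r * p θ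
        + r * inner ℝ x (normalDir θ) + r ^ 2 := fun θ => by ring
  rw [e1]
  simp only [e2]
  rw [intervalIntegral.integral_add, intervalIntegral.integral_add, intervalIntegral.integral_sub,
    intervalIntegral.integral_sub, intervalIntegral.integral_sub,
    intervalIntegral.integral_const_mul, intervalIntegral.integral_const_mul,
    intervalIntegral.integral_const_mul, h.integral_mul_rho, h.integral_inner_normalDir_mul_rho,
    integral_inner_normalDir, h.integral_rho, intervalIntegral.integral_const]
  · simp only [smul_eq_mul]
    field_simp
    ring
  all_goals
    apply Continuous.intervalIntegrable
    fun_prop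

end PeriodicC3

section Bonnesen

variable {K : Set Plane}

theorem sq_perimeter_sub_circumradius_le (hK : IsSmoothStrictlyConvexDomain K) :
    ((∫ θ in (0 : ℝ)..2 * π, supportFun K θ) - 2 * π * circumradius K) ^ 2 ≤
      2 * π * deficit (supportFun K) (deriv (supportFun K)) := by
  have h := hK.regularBoundary.periodicC3
  obtain ⟨x, hx, hopt⟩ := exists_circumcenter hK.isCompact
    (hK.nonempty_interior.mono interior_subset) h.c0
  have hn := continuous_normalDir
  have ht := continuous_tangDir
  have c0 := h.c0
  have c1 := h.c1
  set q : ℝ → ℝ := fun θ => circumradius K - supportFun K θ + inner ℝ x (normalDir θ) with hq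
  have dq : ∀ θ, HasDerivAt q (-deriv (supportFun K) θ + inner ℝ x (tangDir θ)) θ := fun θ =>
    (((h.d0 θ).const_sub _).add (hasDerivAt_inner_normalDir x θ))
  have hper : Function.Periodic q (2 * π) := fun θ => by
    simp only [hq, h.per θ, normalDir_periodic θ]
  have hnn : ∀ θ, 0 ≤ q θ := fun θ => by have := hx θ; simp only [hq]; linarith
  have w := (wirtinger_of_arcs dq (by fun_prop) hper hnn
    (exists_zero_of_optimal (by fun_prop) hper hnn hopt)).1
  have e : ∫ θ in (0 : ℝ)..2 * π, ((-deriv (supportFun K) θ + inner ℝ x (tangDir θ)) ^ 2 -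
      q θ ^ 2) = deficit (supportFun K) (deriv (supportFun K)) -
      ((∫ θ in (0 : ℝ)..2 * π, supportFun K θ) - 2 * π * circumradius K) ^ 2 / (2 * π) := by
    rw [← h.integral_sq_sub_sq x (circumradius K)]
    refine integral_congr fun θ _ => ?_
    simp only [hq]
    ring
  rw [e, sub_nonneg, div_le_iff₀ two_pi_pos] at w
  linarith

/-- Equality makes the gap to the inscribed circle vanish identically, so K coincides with its
incircle. -/
theorem sq_perimeter_sub_inradius_le (hK : IsSmoothStrictlyConvexDomain K) :
    ((∫ θ in (0 : ℝ)..2 * π, supportFun K θ) - 2 * π * inradius K) ^ 2 ≤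
      2 * π * deficit (supportFun K) (deriv (supportFun K)) ∧
    (((∫ θ in (0 : ℝ)..2 * π, supportFun K θ) - 2 * π * inradius K) ^ 2 =
      2 * π * deficit (supportFun K) (deriv (supportFun K)) → IsDisk K) := by
  have h := hK.regularBoundary.periodicC3
  have hneK := hK.nonempty_interior.mono interior_subset
  obtain ⟨hpos, x, hx, hopt⟩ := exists_incenter hK.isCompact hK.strictConvex.convex
    hK.nonempty_interior h.c0
  have hn := continuous_normalDir
  have ht := continuous_tangDir
  have c0 := h.c0
  have c1 := h.c1
  set q : ℝ → ℝ := fun θ => supportFun K θ - inner ℝ x (normalDir θ) - inradius K with hq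
  have dq : ∀ θ, HasDerivAt q (deriv (supportFun K) θ - inner ℝ x (tangDir θ)) θ := fun θ =>
    ((h.d0 θ).sub (hasDerivAt_inner_normalDir x θ)).sub_const _
  have hper : Function.Periodic q (2 * π) := fun θ => by
    simp only [hq, h.per θ, normalDir_periodic θ]
  have hnn : ∀ θ, 0 ≤ q θ := fun θ => by have := hx θ; simp only [hq]; linarith
  obtain ⟨w, weq⟩ := wirtinger_of_arcs dq (by fun_prop) hper hnn
    (exists_zero_of_optimal (by fun_prop) hper hnn hopt)
  rw [h.integral_sq_sub_sq x (inradius K)] at w weq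
  rw [sub_nonneg, div_le_iff₀ two_pi_pos] at w
  refine ⟨by linarith, fun he => ⟨x, inradius K, hpos, ?_⟩⟩
  have hz := weq (by rw [he]; field_simp; ring)
  refine Set.Subset.antisymm ?_ ?_
  · rw [subset_closedBall_iff hK.isCompact hneK]
    intro θ
    have := hz θ
    simp only [hq] at this
    linarith
  · exact (closedBall_subset_iff hK.isCompact hK.strictConvex.convex hneK hpos.le).2 hx

theorem inradius_le_circumradius (hK : IsSmoothStrictlyConvexDomain K) :
    inradius K ≤ circumradius K := by
  have hp := hK.regularBoundary.periodicC3.c0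
  obtain ⟨-, x, hx, -⟩ := exists_incenter hK.isCompact hK.strictConvex.convex
    hK.nonempty_interior hp
  obtain ⟨y, hy, -⟩ := exists_circumcenter hK.isCompact
    (hK.nonempty_interior.mono interior_subset) hp
  have e : ∀ z : Plane, inner ℝ z (normalDir π) = -inner ℝ z (normalDir 0) := fun z => by
    simp [inner_normalDir]
  have h1 := hx 0
  have h2 := hx π
  have h3 := hy 0
  have h4 := hy π
  rw [e] at h2 h4
  linarith

/-- Bonnesen's inequality, with strictness away from disks. -/
theorem bonnesen (hK : IsSmoothStrictlyConvexDomain K) :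
    π * (circumradius K - inradius K) ^ 2 ≤ 2 * deficit (supportFun K) (deriv (supportFun K)) ∧
    (¬IsDisk K → π * (circumradius K - inradius K) ^ 2 <
      2 * deficit (supportFun K) (deriv (supportFun K))) := by
  have h1 := sq_perimeter_sub_circumradius_le hK
  obtain ⟨h2, h3⟩ := sq_perimeter_sub_inradius_le hK
  have h4 := inradius_le_circumradius hK
  set L := ∫ θ in (0 : ℝ)..2 * π, supportFun K θ
  set E := deficit (supportFun K) (deriv (supportFun K))
  set R := circumradius K
  set r := inradius K
  -- Both L - 2πR and L - 2πr are at most √(2πE) in absolute value; the parallelogram law turns this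
  -- into a bound on their difference 2π(R - r).
  have hid : 4 * π * (2 * E - π * (R - r) ^ 2) = 2 * (2 * π * E - (L - 2 * π * R) ^ 2) +
      2 * (2 * π * E - (L - 2 * π * r) ^ 2) + (2 * (L - π * R - π * r)) ^ 2 := by ring
  constructor
  · by_contra! hlt
    nlinarith [sq_nonneg (2 * (L - π * R - π * r)), pi_pos]
  · intro hd
    have h5 : (L - 2 * π * r) ^ 2 < 2 * π * E := lt_of_le_of_ne h2 fun he => hd (h3 he)
    by_contra! hlt
    nlinarith [sq_nonneg (2 * (L - π * R - π * r)), pi_pos]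

theorem rho_mem_Icc (hK : IsSmoothStrictlyConvexDomain K) {θ : ℝ} (hθ : θ ∈ Set.Icc 0 (2 * π)) :
    rho K θ ∈ Set.Icc (rhoMin K) (rhoMax K) := by
  have h := hK.regularBoundary
  have hc : Continuous (rho K) := by
    rw [h.rho_eq]
    exact h.periodicC3.c0.add h.periodicC3.c2
  have hi : IsCompact (rho K '' Set.Icc 0 (2 * π)) := isCompact_Icc.image hc
  exact ⟨csInf_le hi.bddBelow ⟨θ, hθ, rfl⟩, le_csSup hi.bddAbove ⟨θ, hθ, rfl⟩⟩

/-- Bottema's upper bound for the isoperimetric deficit, with an improved constant. -/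
theorem six_mul_deficit_le (hK : IsSmoothStrictlyConvexDomain K) :
    6 * deficit (supportFun K) (deriv (supportFun K)) ≤ π * (rhoMax K - rhoMin K) ^ 2 := by
  have h := hK.regularBoundary
  have h3 := h.periodicC3
  have hrho := h.rho_eq
  have hc : Continuous (rho K) := by
    rw [hrho]
    exact h3.c0.add h3.c2
  have i1 := h3.integral_rho
  have i2 := h3.integral_rho_sq
  have i3 := h3.four_mul_deficit_le
  have hsq : ∫ θ in (0 : ℝ)..2 * π, (supportFun K θ + deriv (deriv (supportFun K)) θ) ^ 2 =
      ∫ θ in (0 : ℝ)..2 * π, rho K θ ^ 2 := by rw [hrho]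
  have hL : ∫ θ in (0 : ℝ)..2 * π, rho K θ = ∫ θ in (0 : ℝ)..2 * π, supportFun K θ := by
    rw [hrho, i1]
  rw [hsq, ← hL] at i2
  -- Integrating (ρ - ρ_m)(ρ_M - ρ) ≥ 0 bounds ∫ρ² - L²/(2π) by π(ρ_M - ρ_m)²/2. The left side
  -- equals X - E, hence is at least 3E.
  have hnn : 0 ≤ ∫ θ in (0 : ℝ)..2 * π, (rho K θ - rhoMin K) * (rhoMax K - rho K θ) :=
    integral_nonneg two_pi_pos.le fun θ hθ => by
      obtain ⟨h1, h2⟩ := rho_mem_Icc hK hθ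
      exact mul_nonneg (by linarith) (by linarith)
  have hexp : ∀ θ, (rho K θ - rhoMin K) * (rhoMax K - rho K θ) =
      (rhoMax K + rhoMin K) * rho K θ - rho K θ ^ 2 - rhoMin K * rhoMax K := fun θ => by ring
  simp only [hexp] at hnn
  rw [intervalIntegral.integral_sub (Continuous.intervalIntegrable (by fun_prop) _ _)
    (Continuous.intervalIntegrable (by fun_prop) _ _), intervalIntegral.integral_sub
    (Continuous.intervalIntegrable (by fun_prop) _ _)
    (Continuous.intervalIntegrable (by fun_prop) _ _), intervalIntegral.integral_const_mul,
    intervalIntegral.integral_const] at hnn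
  set L := ∫ θ in (0 : ℝ)..2 * π, rho K θ
  set M := rhoMax K
  set m := rhoMin K
  have hid : π / 2 * (M - m) ^ 2 - ((M + m) * L - 2 * π * (m * M) - L ^ 2 / (2 * π)) =
      (L - π * (M + m)) ^ 2 / (2 * π) := by
    field_simp
    ring
  have hid2 : 0 ≤ (L - π * (M + m)) ^ 2 / (2 * π) := by positivity
  simp only [smul_eq_mul, sub_zero] at hnn
  linarith

end Bonnesen

/-! ### Assembling the functional W -/

theorem W_eq {K : Set Plane} (hK : IsSmoothStrictlyConvexDomain K) (α δ μ σ η lam ξ : ℝ)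
    (h1 : 2 * α + 4 * π * δ + μ = 0)
    (hE : 0 ≤ deficit (supportFun K) (deriv (supportFun K))) :
    W α δ μ σ η lam ξ 0 K =
      (2 * α + σ) / 2 * ((∫ x in (0 : ℝ)..2 * π, deriv (deriv (supportFun K)) x ^ 2) -
        ∫ x in (0 : ℝ)..2 * π, deriv (supportFun K) x ^ 2)
      - (2 * α + μ) / 2 * deficit (supportFun K) (deriv (supportFun K))
      + η * (∫ x in (0 : ℝ)..2 * π,
        (deriv (supportFun K) x + deriv (deriv (deriv (supportFun K))) x) ^ 2)
      + lam * (circumradius K - inradius K) ^ 2 + ξ * (rhoMax K - rhoMin K) ^ 2 := by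
  have h := hK.regularBoundary
  have h3 := h.periodicC3
  have hX := h3.four_mul_deficit_le
  rw [W, h.rho_eq, h.rhoBeta_eq, h.perimeter_eq, area_eq hK, h.areaTilde_eq,
    h3.integral_deriv_mul_rho_deriv, h3.integral_mul_rho]
  simp only [sq_abs]
  rw [h3.integral_rho_sq]
  set X := (∫ x in (0 : ℝ)..2 * π, deriv (deriv (supportFun K)) x ^ 2) -
        ∫ x in (0 : ℝ)..2 * π, deriv (supportFun K) x ^ 2
  set E := deficit (supportFun K) (deriv (supportFun K))
  set L := ∫ x in (0 : ℝ)..2 * π, supportFun K x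
  -- The evolute has oriented area -X/2, which is nonpositive since X ≥ 4E ≥ 0.
  rw [abs_of_nonpos (by linarith)]
  have hL : α * (L ^ 2 / (2 * π)) + δ * L ^ 2 + μ * (1 / 2 * (L ^ 2 / (2 * π))) = 0 := by
    field_simp
    linear_combination L ^ 2 * h1
  linear_combination hL

/-- Constant ρ gives V = 0, so Bottema's and Bonnesen's inequalities squeeze both E and D to zero.
-/
theorem IsDisk.W_eq_zero {K : Set Plane} (hK : IsSmoothStrictlyConvexDomain K) (hd : IsDisk K)
    (α δ μ σ η lam ξ : ℝ) (h1 : 2 * α + 4 * π * δ + μ = 0) : W α δ μ σ η lam ξ 0 K = 0 := by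
  have h := hK.regularBoundary
  have h3 := h.periodicC3
  obtain ⟨x, r, hr, hKe⟩ := hd
  have hp : supportFun K = fun θ => r + inner ℝ x (normalDir θ) := by
    funext θ
    rw [hKe, supportFun_closedBall x hr.le]
  have hp1 : deriv (supportFun K) = fun θ => inner ℝ x (tangDir θ) := by
    funext θ
    rw [hp]
    exact ((hasDerivAt_inner_normalDir x θ).const_add r).deriv
  have hp2 : deriv (deriv (supportFun K)) = fun θ => -inner ℝ x (normalDir θ) := by
    funext θ
    rw [hp1]
    exact (hasDerivAt_inner_tangDir x θ).deriv
  have hp3 : deriv (deriv (deriv (supportFun K))) = fun θ => -inner ℝ x (tangDir θ) := by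
    funext θ
    rw [hp2]
    exact (hasDerivAt_inner_normalDir x θ).fun_neg.deriv
  have hrho : rho K = fun _ => r := by
    rw [h.rho_eq, hp2, hp]
    funext θ
    ring
  have hne : (Set.Icc 0 (2 * π)).Nonempty := ⟨0, le_rfl, two_pi_pos.le⟩
  have hM : rhoMax K - rhoMin K = 0 := by
    rw [rhoMax, rhoMin, hrho, hne.image_const]
    simp
  have hb := (bonnesen hK).1
  have hE := six_mul_deficit_le hK
  rw [hM] at hE
  have hD : 0 ≤ π * (circumradius K - inradius K) ^ 2 := by positivity
  have hE0 : deficit (supportFun K) (deriv (supportFun K)) = 0 := by linarith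
  have hD0 : (circumradius K - inradius K) ^ 2 = 0 := by
    rw [hE0] at hb
    exact (mul_eq_zero.1 (by linarith : π * (circumradius K - inradius K) ^ 2 = 0)).resolve_left
      pi_ne_zero
  have hX3 : ∫ x in (0 : ℝ)..2 * π,
      (deriv (supportFun K) x + deriv (deriv (deriv (supportFun K))) x) ^ 2 = 0 := by
    rw [hp3, hp1]
    simp
  have hX2 : (∫ x in (0 : ℝ)..2 * π, deriv (deriv (supportFun K)) x ^ 2) -
        ∫ x in (0 : ℝ)..2 * π, deriv (supportFun K) x ^ 2 = 0 := by
    have i2 := h3.integral_rho_sq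
    rw [← h3.integral_rho, hE0] at i2
    have e : ∀ θ, supportFun K θ + deriv (deriv (supportFun K)) θ = r := fun θ => by
      rw [← congrFun hrho θ, h.rho_eq]
    simp only [e, intervalIntegral.integral_const, smul_eq_mul, sub_zero] at i2
    have e2 : (2 * π * r) ^ 2 / (2 * π) = 2 * π * r ^ 2 := by field_simp
    rw [e2] at i2
    linarith
  rw [W_eq hK α δ μ σ η lam ξ h1 hE0.ge, hX2, hX3, hE0, hD0, hM]
  ring

theorem W_nonneg_and_pos {K : Set Plane} (hK : IsSmoothStrictlyConvexDomain K)
    (α δ μ σ η lam ξ : ℝ) (hη : 0 ≤ η) (hξ : 0 ≤ ξ) (hlam : lam ≤ 0)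
    (hpos : 0 < lam ^ 2 + ξ ^ 2) (h1 : 2 * α + 4 * π * δ + μ = 0)
    (h2 : 0 ≤ 2 * α + σ - 2 * η)
    (h3 : 0 ≤ 6 * π * α - π * μ + 4 * π * σ + 24 * π * η + 4 * lam + 4 * ξ) :
    0 ≤ W α δ μ σ η lam ξ 0 K ∧ (¬IsDisk K → 0 < W α δ μ σ η lam ξ 0 K) := by
  have hC := hK.regularBoundary.periodicC3
  have hX2 := hC.four_mul_deficit_le
  have hX3 := hC.twelve_mul_deficit_le
  obtain ⟨hD, hDs⟩ := bonnesen hK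
  have hV := six_mul_deficit_le hK
  have hE : 0 ≤ deficit (supportFun K) (deriv (supportFun K)) := by
    have : 0 ≤ π * (circumradius K - inradius K) ^ 2 := by positivity
    linarith
  rw [W_eq hK α δ μ σ η lam ξ h1 hE]
  have hDnn := sq_nonneg (circumradius K - inradius K)
  have hpi := pi_pos
  set X := (∫ x in (0 : ℝ)..2 * π, deriv (deriv (supportFun K)) x ^ 2) -
        ∫ x in (0 : ℝ)..2 * π, deriv (supportFun K) x ^ 2
  set E := deficit (supportFun K) (deriv (supportFun K))
  set Y := ∫ x in (0 : ℝ)..2 * π,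
        (deriv (supportFun K) x + deriv (deriv (deriv (supportFun K))) x) ^ 2
  set D := (circumradius K - inradius K) ^ 2
  set V := (rhoMax K - rhoMin K) ^ 2
  have a1 : 0 ≤ (2 * α + σ) / 2 * (X - 4 * E) := mul_nonneg (by linarith) (by linarith)
  have a2 : 0 ≤ η * (Y - 12 * E) := mul_nonneg hη (by linarith)
  have a3 : 0 ≤ (6 * π * α - π * μ + 4 * π * σ + 24 * π * η + 4 * lam + 4 * ξ) * E :=
    mul_nonneg h3 hE
  -- The slack between the two sides is π times `a1` and `a2` plus half of `a3`.
  have key : -lam * (2 * E - π * D) + ξ * (π * V - 2 * E) ≤ π * ((2 * α + σ) / 2 * X -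
      (2 * α + μ) / 2 * E + η * Y + lam * D + ξ * V) := by
    have b1 := mul_nonneg hpi.le a1
    have b2 := mul_nonneg hpi.le a2
    linarith
  have k1 : 0 ≤ -lam * (2 * E - π * D) := mul_nonneg (by linarith) (by linarith)
  have k2 : 0 ≤ ξ * (π * V - 2 * E) := mul_nonneg hξ (by linarith)
  refine ⟨?_, fun hd => ?_⟩
  · exact le_of_mul_le_mul_left (by linarith) hpi
  · have s1 := hDs hd
    have hE0 : 0 < E := by
      have : 0 ≤ π * D := by positivity
      linarith
    refine lt_of_mul_lt_mul_left (a := π) ?_ hpi.le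
    rw [mul_zero]
    -- If λ < 0, strict Bonnesen decides. Otherwise ξ > 0, and πV ≥ 6E > 2E, which is where the
    -- improved Bottema constant is needed.
    rcases hlam.lt_or_eq with hl | hl
    · have : 0 < -lam * (2 * E - π * D) := mul_pos (by linarith) (by linarith)
      linarith
    · have hξ0 : ξ ≠ 0 := by
        rintro rfl
        simp [hl] at hpos
      have : 0 < ξ * (π * V - 2 * E) := mul_pos (hξ.lt_of_ne hξ0.symm) (by linarith)
      linarith

end PlaneConvex

end

theorem corollary3 (α δ μ σ η lam ξ ζ : ℝ)
    (hη : 0 ≤ η) (hξ : 0 ≤ ξ) (hlam : lam ≤ 0) (hpos : 0 < lam ^ 2 + ξ ^ 2)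
    (hζ : ζ = 0) (h1 : 2 * α + 4 * Real.pi * δ + μ = 0)
    (h2 : 0 ≤ 2 * α + σ - 2 * η)
    (h3 : 0 ≤ 6 * Real.pi * α - Real.pi * μ + 4 * Real.pi * σ + 24 * Real.pi * η
      + 4 * lam + 4 * ξ)
    (K : Set PlaneConvex.Plane) (hK : PlaneConvex.IsSmoothStrictlyConvexDomain K) :
    0 ≤ PlaneConvex.W α δ μ σ η lam ξ ζ K ∧
      (PlaneConvex.IsDisk K ↔ PlaneConvex.W α δ μ σ η lam ξ ζ K = 0) := by
  subst hζ
  obtain ⟨hnn, hdisk⟩ :=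
    PlaneConvex.W_nonneg_and_pos hK α δ μ σ η lam ξ hη hξ hlam hpos h1 h2 h3
  exact ⟨hnn, fun hd => hd.W_eq_zero hK α δ μ σ η lam ξ h1,
    fun hW => by_contra fun hd => (hdisk hd).ne' hW⟩
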